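/- **Setting.** Let $V$ be a finite set of qubits. For a simple graph $G=(V,E)$, let $|G\rangle=\bigl(\prod_{\{u,v\}\in E}\Lambda Z_{uv}\bigr)\bigl(\prod_{v\in V}H_v\bigr)|0\rangle^{\otimes V}$ be its graph state; it is, up to a scalar, the only vector with $X_v\prod_{u\in\operatorname{ngbh}v}Z_u\,|G\rangle=|G\rangle$ for all $v\in V$. Here $\operatorname{ngbh}v$ is the set of neighbours of $v$, and $\Lambda Z_{uv}$ is the controlled phase gate, diagonal with entry $-1$ exactly where both qubits are $1$. Let $\mathcal C_1$ be the group of one-qubit unitaries that normalize the Pauli group $\{\pm1,\pm i\}\cdot\{I,X,Y,Z\}$. For $C_v\in\mathcal C_1$ $(v\in V)$ put $|G;C\rangle=\bigotimes_v C_v\,|G\rangle$. The $C_v$ are called vertex operators (VOPs). They are considered modulo global phases, so that $|G;C\rangle$ is defined up to a global phase, and equalities between VOPs are meant modulo phases. A pair $(G,C)$ *represents* a vector $\psi$ if $\psi=z\,|G;C\rangle$ with $|z|=1$. Let $S=\operatorname{diag}(1,i)$, $\mathcal Z=\{I,Z,S,S^\dagger\}$, $\sqrt{\pm iX}=(I\pm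 iX)/\sqrt2$, $\sqrt{\pm iZ}=(I\pm iZ)/\sqrt2$. *Local complementation* about $v$ replaces $E$ by $E\vartriangle\{\{u,w\}: u\ne w,\ u,w\in\operatorname{ngbh}v\}$, $C_v$ by $C_v\sqrt{iX}$, and $C_u$ by $C_u\sqrt{-iZ}$ for every $u\in\operatorname{ngbh}v$ (neighbourhood before the operation). A *decomposition table* assigns to each $C\in\mathcal C_1$ (modulo phase) a word of length at most $5$ in the letters $\sqrt{-iX},\sqrt{iZ}$ whose product is $C$ up to a phase. *Reducing* vertex $a$ with swapping partner $c$ means: read the word of $C_a$ from right to left, doing a local complementation about $a$ for each letter $\sqrt{-iX}$ and about $c$ for each letter $\sqrt{iZ}$. A *phase table* is a map $(\zeta,C_1,C_2)\mapsto(\zeta',C_1',C_2')$ with $\zeta,\zeta'\in\{0,1\}$ and VOPs $C_i,C_i'$ such that, for the two-vertex graphs $G_0$ (no edge) and $G_1$ (one edge), $\Lambda Z_{12}|G_\zeta;C_1,C_2\rangle=z\,|G_{\zeta'};C'_1,C'_2\rangle$ with $|z|=1$. It satisfies *Constraint 1* if always $C_1\in\mathcal Z\Rightarrow C_1'\in\mathcal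 Z$ and $C_2\in\mathcal Z\Rightarrow C_2'\in\mathcal Z$. *Looking up* $\{a,b\}$ replaces the presence bit $\zeta$ of the edge $\{a,b\}$ together with $C_a,C_b$ by the table's value at $(\zeta,C_a,C_b)$ and leaves the rest unchanged. The procedure $\mathtt{cphase}(a,b)$ on $(G,C)$ is: (1) if $\operatorname{ngbh}a\setminus\{b\}\neq\emptyset$, reduce $a$ with an arbitrarily chosen swapping partner in $\operatorname{ngbh}a\setminus\{b\}$; (2) if now $\operatorname{ngbh}b\setminus\{a\}\neq\emptyset$, reduce $b$ with an arbitrarily chosen swapping partner in $\operatorname{ngbh}b\setminus\{a\}$; (3) repeat step (1); (4) look up $\{a,b\}$ in the phase table. **Theorem.** Decomposition tables exist, and phase tables satisfying Constraint 1 exist. Fix any of each. Let $V$ be finite, $a\neq b$ in $V$, and let $(G,C)$ represent $\psi$. Then: 1. If $C_a,C_b\in\mathcal Z$, toggling the edge $\{a,b\}$ (and keeping $C$) gives a pair that represents $\Lambda Z_{ab}\psi$. 2. If $c\in\operatorname{ngbh}a$, then reducing $a$ with swapping partner $c$ uses at most $5$ local complementations; the resulting pair still represents $\psi$, has VOP $I$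 at $a$, and still has the edge $\{a,c\}$; the VOP of each vertex other than $a,c$ has only been right-multiplied by an element of $\mathcal Z$. 3. If $a$ is reduced with a partner $c\in\operatorname{ngbh}a\setminus\{b\}$ and then $b$ with a partner $d\in\operatorname{ngbh}b\setminus\{a\}$ (neighbourhood after the first reduction), then the VOP of $a$ is in $\mathcal Z$, that of $b$ is $I$, and toggling the edge $\{a,b\}$ now gives a pair that represents $\Lambda Z_{ab}\psi$. 4. If ($\operatorname{ngbh}a\subseteq\{b\}$ or $C_a\in\mathcal Z$) and ($\operatorname{ngbh}b\subseteq\{a\}$ or $C_b\in\mathcal Z$), then looking up $\{a,b\}$ in the phase table gives a pair that represents $\Lambda Z_{ab}\psi$. 5. The procedure $\mathtt{cphase}(a,b)$ can be carried out. For all choices of swapping partners, the pair obtained after steps (1)–(3) still represents $\psi$ and satisfies the hypothesis of 4, and the final pair represents $\Lambda Z_{ab}\psi$. -/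

import Mathlib

open scoped symmDiff

noncomputable section

/-! ### Single-qubit matrices, the Pauli group and the local Clifford group -/

/-- `2 × 2` complex matrices, i.e. operators on one qubit. -/
abbrev QMat := Matrix (Fin 2) (Fin 2) ℂ

def pauliX : QMat := !![0, 1; 1, 0]

def pauliY : QMat := !![0, -Complex.I; Complex.I, 0]

def pauliZ : QMat := !![1, 0; 0, -1]

def hadamardMat : QMat := ((Real.sqrt 2 : ℝ) : ℂ)⁻¹ • !![1, 1; 1, -1]

def phaseMat : QMat := !![1, 0; 0, Complex.I]

/-- `√(iX) = exp(iπX/4) = (I + iX)/√2`. -/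
def sqrtIXMat : QMat := ((Real.sqrt 2 : ℝ) : ℂ)⁻¹ • (1 + Complex.I • pauliX)

/-- `√(-iZ) = exp(-iπZ/4) = (I - iZ)/√2`, which is `exp(-iπ/4) S`. -/
def sqrtNegIZMat : QMat := ((Real.sqrt 2 : ℝ) : ℂ)⁻¹ • (1 - Complex.I • pauliZ)

/-- The one-qubit Pauli group `{±1, ±i} · {I, X, Y, Z}`. -/
def pauliGroup : Set (Matrix.unitaryGroup (Fin 2) ℂ) :=
  {P | ∃ c ∈ ({1, -1, Complex.I, -Complex.I} : Set ℂ),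
    ∃ σ ∈ ({1, pauliX, pauliY, pauliZ} : Set QMat), (P : QMat) = c • σ}

/-- The one-qubit Clifford operators: the unitaries that normalize the Pauli group. -/
def cliffordOps : Subgroup (Matrix.unitaryGroup (Fin 2) ℂ) :=
  Subgroup.normalizer pauliGroup

/-- The Clifford operators that are a mere global phase. -/
def globalPhases : Subgroup cliffordOps where
  carrier := {U | ∃ z : ℂ, ((U : Matrix.unitaryGroup (Fin 2) ℂ) : QMat) = z • 1}
  one_mem' := ⟨1, by simp⟩
  mul_mem' := by
    rintro U W ⟨z, hz⟩ ⟨w, hw⟩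
    exact ⟨z * w, by simp [hz, hw, smul_smul, mul_comm]⟩
  inv_mem' := by
    rintro U ⟨z, hz⟩
    refine ⟨star z, ?_⟩
    have : (((U⁻¹ : cliffordOps) : Matrix.unitaryGroup (Fin 2) ℂ) : QMat)
        = star ((U : Matrix.unitaryGroup (Fin 2) ℂ) : QMat) := rfl
    rw [this, hz, star_smul, star_one]

instance globalPhases_normal : globalPhases.Normal where
  conj_mem := by
    rintro U ⟨z, hz⟩ W
    refine ⟨z, ?_⟩
    have h1 : (((W * U * W⁻¹ : cliffordOps) : Matrix.unitaryGroup (Fin 2) ℂ) : QMat)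
        = ((W : Matrix.unitaryGroup (Fin 2) ℂ) : QMat)
          * ((U : Matrix.unitaryGroup (Fin 2) ℂ) : QMat)
          * (((W⁻¹ : cliffordOps) : Matrix.unitaryGroup (Fin 2) ℂ) : QMat) := rfl
    rw [h1, hz]
    simp

/-- The local Clifford group with global phases disregarded (24 elements);
vertex operators are elements of this group. -/
abbrev LocalClifford := cliffordOps ⧸ globalPhases

/-- The class modulo global phase of a Clifford operator. -/
def cliffordClass (U : cliffordOps) : LocalClifford := QuotientGroup.mk U

/-- The `2 × 2` matrix of a Clifford operator. -/
def cliffordMat (U : cliffordOps) : QMat := ((U : Matrix.unitaryGroup (Fin 2) ℂ) : QMat)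

/-- A unitary is Clifford if conjugation by it and by its inverse sends each of `X, Y, Z` to
plus or minus one of `X, Y, Z`. -/
theorem mem_cliffordOps_of_conj (U : Matrix.unitaryGroup (Fin 2) ℂ)
    (h : ∀ σ ∈ ({pauliX, pauliY, pauliZ} : Set QMat),
      ∃ τ ∈ ({pauliX, pauliY, pauliZ} : Set QMat),
        (U : QMat) * σ * star (U : QMat) = τ ∨ (U : QMat) * σ * star (U : QMat) = -τ)
    (h' : ∀ σ ∈ ({pauliX, pauliY, pauliZ} : Set QMat),
      ∃ τ ∈ ({pauliX, pauliY, pauliZ} : Set QMat),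
        star (U : QMat) * σ * (U : QMat) = τ ∨ star (U : QMat) * σ * (U : QMat) = -τ) :
    U ∈ cliffordOps := by
  have hU : (U : QMat) * star (U : QMat) = 1 := Matrix.mem_unitaryGroup_iff.1 U.2
  have hU' : star (U : QMat) * (U : QMat) = 1 := Matrix.UnitaryGroup.star_mul_self U
  have neg : ∀ c ∈ ({1, -1, Complex.I, -Complex.I} : Set ℂ),
      -c ∈ ({1, -1, Complex.I, -Complex.I} : Set ℂ) := by
    rintro c (rfl | rfl | rfl | rfl) <;> simp
  have key : ∀ A B : QMat, A * B = 1 →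
      (∀ σ ∈ ({pauliX, pauliY, pauliZ} : Set QMat),
        ∃ τ ∈ ({pauliX, pauliY, pauliZ} : Set QMat), A * σ * B = τ ∨ A * σ * B = -τ) →
      ∀ M : QMat, (∃ c ∈ ({1, -1, Complex.I, -Complex.I} : Set ℂ),
        ∃ σ ∈ ({1, pauliX, pauliY, pauliZ} : Set QMat), M = c • σ) →
      (∃ c ∈ ({1, -1, Complex.I, -Complex.I} : Set ℂ),
        ∃ σ ∈ ({1, pauliX, pauliY, pauliZ} : Set QMat), A * M * B = c • σ) := by
    rintro A B hAB hc M ⟨c, hcm, σ, hσ, rfl⟩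
    rcases hσ with rfl | hσ
    · exact ⟨c, hcm, 1, Or.inl rfl, by simp [hAB]⟩
    · obtain ⟨τ, hτ, e | e⟩ := hc σ hσ
      · exact ⟨c, hcm, τ, Or.inr hτ, by simp [e]⟩
      · exact ⟨-c, neg c hcm, τ, Or.inr hτ, by simp [e]⟩
  intro P
  constructor
  · intro hP
    exact key _ _ hU h P hP
  · intro hP
    have := key _ _ hU' h' _ hP
    have e : star (U : QMat) * ((U * P * U⁻¹ : Matrix.unitaryGroup (Fin 2) ℂ) : QMat) * (U : QMat)
        = P := by
      change star (U : QMat) * ((U : QMat) * (P : QMat) * star (U : QMat)) * (U : QMat) = P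
      calc _ = (star (U : QMat) * (U : QMat)) * (P : QMat) * (star (U : QMat) * (U : QMat)) := by
            simp only [mul_assoc]
        _ = P := by simp [hU']
    rw [e] at this
    exact this

theorem sqrt_two_inv_mul_self :
    ((Real.sqrt 2 : ℝ) : ℂ)⁻¹ * ((Real.sqrt 2 : ℝ) : ℂ)⁻¹ = 1 / 2 := by
  rw [← mul_inv, ← Complex.ofReal_mul, Real.mul_self_sqrt (by norm_num)]
  norm_num


/-- The phase gate `S` as a Clifford operator. -/
def phaseOp : cliffordOps :=
  ⟨⟨phaseMat, by
      rw [Matrix.mem_unitaryGroup_iff]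
      ext i j
      fin_cases i <;> fin_cases j <;> simp [phaseMat, Matrix.mul_apply]⟩, by
    apply mem_cliffordOps_of_conj
    · rintro σ (rfl | rfl | rfl)
      · refine ⟨pauliY, by simp, Or.inl ?_⟩
        ext i j
        fin_cases i <;> fin_cases j <;>
          simp [phaseMat, pauliX, pauliY, Matrix.mul_apply]
      · refine ⟨pauliX, by simp, Or.inr ?_⟩
        ext i j
        fin_cases i <;> fin_cases j <;>
          simp [phaseMat, pauliX, pauliY, Matrix.mul_apply]
      · refine ⟨pauliZ, by simp, Or.inl ?_⟩
        ext i j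
        fin_cases i <;> fin_cases j <;>
          simp [phaseMat, pauliZ, Matrix.mul_apply]
    · rintro σ (rfl | rfl | rfl)
      · refine ⟨pauliY, by simp, Or.inr ?_⟩
        ext i j
        fin_cases i <;> fin_cases j <;>
          simp [phaseMat, pauliX, pauliY, Matrix.mul_apply]
      · refine ⟨pauliX, by simp, Or.inl ?_⟩
        ext i j
        fin_cases i <;> fin_cases j <;>
          simp [phaseMat, pauliX, pauliY, Matrix.mul_apply]
      · refine ⟨pauliZ, by simp, Or.inl ?_⟩
        ext i j
        fin_cases i <;> fin_cases j <;>
          simp [phaseMat, pauliZ, Matrix.mul_apply]⟩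

/-- The Pauli matrix `Z` as a Clifford operator. -/
def zOp : cliffordOps :=
  ⟨⟨pauliZ, by
      rw [Matrix.mem_unitaryGroup_iff]
      ext i j
      fin_cases i <;> fin_cases j <;> simp [pauliZ, Matrix.mul_apply]⟩, by
    have e : (phaseMat * phaseMat : QMat) = pauliZ := by
      ext i j
      fin_cases i <;> fin_cases j <;> simp [phaseMat, pauliZ, Matrix.mul_apply]
    have h := (phaseOp * phaseOp).2
    convert h using 1
    exact Subtype.ext e.symm⟩

theorem sqrtIXMat_eq : sqrtIXMat =
    !![((Real.sqrt 2 : ℝ) : ℂ)⁻¹, ((Real.sqrt 2 : ℝ) : ℂ)⁻¹ * Complex.I;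
       ((Real.sqrt 2 : ℝ) : ℂ)⁻¹ * Complex.I, ((Real.sqrt 2 : ℝ) : ℂ)⁻¹] := by
  ext i j
  fin_cases i <;> fin_cases j <;> simp [sqrtIXMat, pauliX]

/-- `√(iX)` as a Clifford operator. -/
def sqrtIXOp : cliffordOps :=
  ⟨⟨sqrtIXMat, by
      rw [Matrix.mem_unitaryGroup_iff, sqrtIXMat_eq]
      have h := sqrt_two_inv_mul_self
      set s := ((Real.sqrt 2 : ℝ) : ℂ)⁻¹ with hs
      have hc : (starRingEnd ℂ) s = s := by simp [hs]
      have hI := Complex.I_mul_I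
      ext i j
      fin_cases i <;> fin_cases j <;> simp [Matrix.mul_apply, hc] <;> grind⟩, by
    have h := sqrt_two_inv_mul_self
    apply mem_cliffordOps_of_conj
    all_goals
      simp only [sqrtIXMat_eq]
      set s := ((Real.sqrt 2 : ℝ) : ℂ)⁻¹ with hs
      have hc : (starRingEnd ℂ) s = s := by simp [hs]
      have hI := Complex.I_mul_I
    · rintro σ (rfl | rfl | rfl)
      · refine ⟨pauliX, by simp, Or.inl ?_⟩
        ext i j
        fin_cases i <;> fin_cases j <;> simp [pauliX, Matrix.mul_apply, hc] <;> grind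
      · refine ⟨pauliZ, by simp, Or.inr ?_⟩
        ext i j
        fin_cases i <;> fin_cases j <;> simp [pauliY, pauliZ, Matrix.mul_apply, hc] <;> grind
      · refine ⟨pauliY, by simp, Or.inl ?_⟩
        ext i j
        fin_cases i <;> fin_cases j <;> simp [pauliY, pauliZ, Matrix.mul_apply, hc] <;> grind
    · rintro σ (rfl | rfl | rfl)
      · refine ⟨pauliX, by simp, Or.inl ?_⟩
        ext i j
        fin_cases i <;> fin_cases j <;> simp [pauliX, Matrix.mul_apply, hc] <;> grind
      · refine ⟨pauliZ, by simp, Or.inl ?_⟩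
        ext i j
        fin_cases i <;> fin_cases j <;> simp [pauliY, pauliZ, Matrix.mul_apply, hc] <;> grind
      · refine ⟨pauliY, by simp, Or.inr ?_⟩
        ext i j
        fin_cases i <;> fin_cases j <;> simp [pauliY, pauliZ, Matrix.mul_apply, hc] <;> grind⟩

theorem sqrtNegIZMat_eq : sqrtNegIZMat =
    !![((Real.sqrt 2 : ℝ) : ℂ)⁻¹ * (1 - Complex.I), 0;
       0, ((Real.sqrt 2 : ℝ) : ℂ)⁻¹ * (1 + Complex.I)] := by
  ext i j
  fin_cases i <;> fin_cases j <;> simp [sqrtNegIZMat, pauliZ]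

/-- `√(-iZ)` as a Clifford operator. -/
def sqrtNegIZOp : cliffordOps :=
  ⟨⟨sqrtNegIZMat, by
      rw [Matrix.mem_unitaryGroup_iff, sqrtNegIZMat_eq]
      have h := sqrt_two_inv_mul_self
      set s := ((Real.sqrt 2 : ℝ) : ℂ)⁻¹ with hs
      have hc : (starRingEnd ℂ) s = s := by simp [hs]
      have hI := Complex.I_mul_I
      ext i j
      fin_cases i <;> fin_cases j <;> simp [Matrix.mul_apply, hc] <;> grind⟩, by
    have h := sqrt_two_inv_mul_self
    apply mem_cliffordOps_of_conj
    all_goals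
      simp only [sqrtNegIZMat_eq]
      set s := ((Real.sqrt 2 : ℝ) : ℂ)⁻¹ with hs
      have hc : (starRingEnd ℂ) s = s := by simp [hs]
      have hI := Complex.I_mul_I
    · rintro σ (rfl | rfl | rfl)
      · refine ⟨pauliY, by simp, Or.inl ?_⟩
        ext i j
        fin_cases i <;> fin_cases j <;> simp [pauliX, pauliY, Matrix.mul_apply, hc] <;> grind
      · refine ⟨pauliX, by simp, Or.inr ?_⟩
        ext i j
        fin_cases i <;> fin_cases j <;> simp [pauliX, pauliY, Matrix.mul_apply, hc] <;> grind
      · refine ⟨pauliZ, by simp, Or.inl ?_⟩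
        ext i j
        fin_cases i <;> fin_cases j <;> simp [pauliZ, Matrix.mul_apply, hc] <;> grind
    · rintro σ (rfl | rfl | rfl)
      · refine ⟨pauliY, by simp, Or.inr ?_⟩
        ext i j
        fin_cases i <;> fin_cases j <;> simp [pauliX, pauliY, Matrix.mul_apply, hc] <;> grind
      · refine ⟨pauliX, by simp, Or.inl ?_⟩
        ext i j
        fin_cases i <;> fin_cases j <;> simp [pauliX, pauliY, Matrix.mul_apply, hc] <;> grind
      · refine ⟨pauliZ, by simp, Or.inl ?_⟩
        ext i j
        fin_cases i <;> fin_cases j <;> simp [pauliZ, Matrix.mul_apply, hc] <;> grind⟩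

/-- `√(iX)` modulo global phase. -/
def sqrtIX : LocalClifford := cliffordClass sqrtIXOp

/-- `√(-iZ)` modulo global phase. -/
def sqrtNegIZ : LocalClifford := cliffordClass sqrtNegIZOp

/-- `√(-iX) = √(iX)†` modulo global phase. -/
def sqrtNegIX : LocalClifford := sqrtIX⁻¹

/-- `√(iZ) = √(-iZ)†` modulo global phase. -/
def sqrtIZ : LocalClifford := sqrtNegIZ⁻¹

/-- The set `𝒵 = {I, Z, S, S†}` of local Clifford operators (modulo global phase). -/
def zSet : Set LocalClifford :=
  {1, cliffordClass zOp, cliffordClass phaseOp, cliffordClass phaseOp⁻¹}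

/-! ### Multi-qubit operators, graph states -/

/-- Vectors of the qubit register `(ℂ²)^{⊗V}`, by their amplitudes in the computational basis. -/
abbrev QState (V : Type*) := (V → Fin 2) → ℂ

/-- Operators on the qubit register. -/
abbrev QOp (V : Type*) := Matrix (V → Fin 2) (V → Fin 2) ℂ

/-- The tensor product `⨂_v A_v` of single-qubit operators. -/
def tensorOp {V : Type*} [Fintype V] (A : V → QMat) : QOp V :=
  Matrix.of fun x y => ∏ v, A v (x v) (y v)

/-- The diagonal of the controlled phase gate on the pair of qubits `e`: the sign is `-1` exactly
on the basis states in which both qubits of `e` are `1`. -/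
def czSign {V : Type*} (e : Sym2 V) (x : V → Fin 2) : ℂ :=
  open Classical in if ∀ v ∈ e, x v = 1 then -1 else 1

/-- The controlled phase gate `ΛZ_{ab}`. -/
def controlledZ {V : Type*} [Fintype V] [DecidableEq V] (a b : V) : QOp V := Matrix.diagonal (czSign s(a, b))

/-- The graph state `|G⟩ = (∏_{{a,b} ∈ E} ΛZ_{ab}) (∏_a H_a) |0…0⟩`.
The phase gates are diagonal, so their product is taken entrywise on the diagonals. -/
def graphState {V : Type*} [Fintype V] [DecidableEq V] (G : SimpleGraph V) : QState V :=
  open Classical in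
  Matrix.mulVec (Matrix.diagonal (∏ e ∈ G.edgeFinset, czSign e))
    (Matrix.mulVec (tensorOp fun _ => hadamardMat) (Pi.single (fun _ => 0) 1))

/-- The correlation operator `K_G^{(a)} = X_a ∏_{b ∈ ngbh a} Z_b`. -/
def correlationOp {V : Type*} [Fintype V] [DecidableEq V] (G : SimpleGraph V) (a : V) : QOp V :=
  open Classical in
  tensorOp fun v => if v = a then pauliX else if G.Adj a v then pauliZ else 1

/-- `φ = z ψ` for a complex number `z` of modulus `1`. -/
def EqUpToPhase {V : Type*} (φ ψ : QState V) : Prop := ∃ z : ℂ, ‖z‖ = 1 ∧ φ = z • ψ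

theorem tensorOp_mulVec_monomial {V : Type*} [Fintype V] [DecidableEq V]
    (A : V → QMat) (p : V → Fin 2 → Fin 2) (d : V → Fin 2 → ℂ)
    (h : ∀ v i j, A v i j = if j = p v i then d v i else 0) (ψ : QState V) (x : V → Fin 2) :
    Matrix.mulVec (tensorOp A) ψ x = (∏ v, d v (x v)) * ψ (fun v => p v (x v)) := by
  change ∑ y, (∏ v, A v (x v) (y v)) * ψ y = _
  rw [Finset.sum_eq_single (fun v => p v (x v))]
  · simp [h]
  · intro y _ hy
    obtain ⟨v, hv⟩ : ∃ v, y v ≠ p v (x v) := by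
      by_contra! hc
      exact hy (funext hc)
    rw [Finset.prod_eq_zero (Finset.mem_univ v), zero_mul]
    simp [h, hv]
  · simp

theorem graphState_apply {V : Type*} [Fintype V] [DecidableEq V]
    (G : SimpleGraph V) (x : V → Fin 2) :
    graphState G x = (open Classical in ∏ e ∈ G.edgeFinset, czSign e x)
      * (((Real.sqrt 2 : ℝ) : ℂ)⁻¹) ^ Fintype.card V := by
  classical
  have h : Matrix.mulVec (tensorOp fun _ : V => hadamardMat) (Pi.single (fun _ => 0) 1) x
      = (((Real.sqrt 2 : ℝ) : ℂ)⁻¹) ^ Fintype.card V := by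
    rw [Matrix.mulVec_single_one]
    have : ∀ i : Fin 2, hadamardMat i 0 = ((Real.sqrt 2 : ℝ) : ℂ)⁻¹ := by
      intro i
      fin_cases i <;> simp [hadamardMat]
    simp [tensorOp, this]
  rw [graphState, Matrix.mulVec_diagonal, h, Finset.prod_apply]

theorem correlationOp_mulVec {V : Type*} [Fintype V] [DecidableEq V]
    (G : SimpleGraph V) (a : V) (ψ : QState V) (x : V → Fin 2) :
    Matrix.mulVec (correlationOp G a) ψ x
      = (open Classical in ∏ v, if G.Adj a v ∧ x v = 1 then (-1 : ℂ) else 1)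
        * ψ (Function.update x a (x a + 1)) := by
  classical
  rw [correlationOp, tensorOp_mulVec_monomial _ (fun v i => if v = a then i + 1 else i)
    (fun v i => if G.Adj a v ∧ i = 1 then (-1 : ℂ) else 1)]
  · congr 2
    ext v
    by_cases hv : v = a
    · subst hv; simp
    · simp [hv]
  · intro v i j
    by_cases hv : v = a
    · subst hv
      fin_cases i <;> fin_cases j <;> simp [pauliX]
    · by_cases hg : G.Adj a v
      · fin_cases i <;> fin_cases j <;> simp [hv, hg, pauliZ]
      · fin_cases i <;> fin_cases j <;> simp [hv, hg]

theorem prod_czSign_update {V : Type*} [Fintype V] [DecidableEq V]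
    (G : SimpleGraph V) (a : V) (x : V → Fin 2) :
    (open Classical in ∏ e ∈ G.edgeFinset, czSign e x)
      = (open Classical in ∏ v, if G.Adj a v ∧ x v = 1 then (-1 : ℂ) else 1)
        * (open Classical in ∏ e ∈ G.edgeFinset, czSign e (Function.update x a (x a + 1))) := by
  classical
  have h1 : (∏ v, if G.Adj a v ∧ x v = 1 then (-1 : ℂ) else 1)
      = ∏ e ∈ G.edgeFinset,
        if a ∈ e ∧ ∀ v ∈ e, v ≠ a → x v = 1 then (-1 : ℂ) else 1 := by
    rw [← Finset.prod_filter_mul_prod_filter_not G.edgeFinset (fun e => a ∈ e)]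
    rw [Finset.prod_congr rfl (g := fun _ => (1 : ℂ))
      (s₁ := G.edgeFinset.filter fun e => ¬ a ∈ e), Finset.prod_const_one, mul_one]
    swap
    · intro e he
      simp [(Finset.mem_filter.1 he).2]
    rw [← Finset.prod_filter_mul_prod_filter_not Finset.univ (fun v => G.Adj a v)]
    rw [Finset.prod_congr rfl (g := fun _ => (1 : ℂ))
      (s₁ := Finset.univ.filter fun v => ¬ G.Adj a v), Finset.prod_const_one, mul_one]
    swap
    · intro e he
      simp [(Finset.mem_filter.1 he).2]
    refine Finset.prod_bij (fun v _ => s(a, v)) ?_ ?_ ?_ ?_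
    · intro v hv
      simpa using hv
    · intro v _ w _ hvw
      exact Sym2.congr_right.1 hvw
    · intro e he
      rw [Finset.mem_filter] at he
      obtain ⟨w, rfl⟩ := he.2
      exact ⟨w, by simpa using he.1, rfl⟩
    · intro v hv
      have hg : G.Adj a v := by simpa using hv
      have : v ≠ a := hg.ne'
      simp [hg, this]
  rw [h1, ← Finset.prod_mul_distrib]
  refine Finset.prod_congr rfl fun e he => ?_
  induction e with
  | _ p q =>
    have hpq : p ≠ q := by
      have : G.Adj p q := by simpa using he
      exact this.ne
    have hx : x a = 0 ∨ x a = 1 := by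
      generalize x a = i
      fin_cases i <;> simp
    by_cases hp : p = a
    · subst hp
      rcases hx with hx | hx <;> by_cases hq : x q = 1 <;>
        simp [czSign, hx, hq, hpq.symm]
    · by_cases hq : q = a
      · subst hq
        rcases hx with hx | hx <;> by_cases hq : x p = 1 <;>
          simp [czSign, hx, hq, hpq]
      · simp [czSign, hp, hq, Ne.symm hp, Ne.symm hq]

/-- The graph state is, up to a scalar factor, the unique solution of the eigenvalue equations
`K_G^{(a)} ψ = ψ`, `a ∈ V`. -/
theorem correlationOp_fixed_iff {V : Type*} [Fintype V] [DecidableEq V]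
    (G : SimpleGraph V) (ψ : QState V) :
    (∀ a, Matrix.mulVec (correlationOp G a) ψ = ψ) ↔ ∃ z : ℂ, ψ = z • graphState G := by
  classical
  have hg0 : ∀ x, graphState G x ≠ 0 := by
    intro x
    rw [graphState_apply]
    refine mul_ne_zero (Finset.prod_ne_zero_iff.2 fun e _ => ?_) (by simp)
    unfold czSign
    split_ifs <;> simp
  have hg : ∀ a x, graphState G x
      = (∏ v, if G.Adj a v ∧ x v = 1 then (-1 : ℂ) else 1)
        * graphState G (Function.update x a (x a + 1)) := by
    intro a x
    rw [graphState_apply, graphState_apply, ← mul_assoc, ← prod_czSign_update]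
  constructor
  · intro h
    have hψ : ∀ a x, ψ x = (∏ v, if G.Adj a v ∧ x v = 1 then (-1 : ℂ) else 1)
        * ψ (Function.update x a (x a + 1)) := by
      intro a x
      rw [← correlationOp_mulVec, h a]
    have hr : ∀ a x, ψ x / graphState G x
        = ψ (Function.update x a (x a + 1)) / graphState G (Function.update x a (x a + 1)) := by
      intro a x
      rw [hψ a x, hg a x, mul_div_mul_left]
      refine Finset.prod_ne_zero_iff.2 fun v _ => ?_
      split_ifs <;> simp
    have hc : ∀ (s : Finset V) (x : V → Fin 2), (∀ v ∉ s, x v = 0) →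
        ψ x / graphState G x = ψ (fun _ => 0) / graphState G (fun _ => 0) := by
      intro s
      induction s using Finset.induction_on with
      | empty =>
        intro x hx
        rw [show x = fun _ => 0 from funext fun v => hx v (by simp)]
      | insert a s ha ih =>
        intro x hx
        have hxa : x a = 0 ∨ x a = 1 := by
          generalize x a = i
          fin_cases i <;> simp
        rcases hxa with hxa | hxa
        · refine ih x fun v hv => ?_
          by_cases hva : v = a
          · rw [hva, hxa]
          · exact hx v (by simp [hva, hv])
        · rw [hr a x]
          refine ih _ fun v hv => ?_
          by_cases hva : v = a
          · subst hva
            simp [hxa]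
          · simpa [hva] using hx v (by simp [hva, hv])
    refine ⟨ψ (fun _ => 0) / graphState G (fun _ => 0), funext fun x => ?_⟩
    rw [Pi.smul_apply, smul_eq_mul, ← hc Finset.univ x (by simp), div_mul_cancel₀ _ (hg0 x)]
  · rintro ⟨z, rfl⟩ a
    rw [Matrix.mulVec_smul]
    congr 1
    funext x
    rw [correlationOp_mulVec, ← hg]

/-- The state `|G; C⟩ = (⨂_v C_v) |G⟩`. -/
def vopState {V : Type*} [Fintype V] [DecidableEq V] (G : SimpleGraph V) (C : V → cliffordOps) :
    QState V :=
  Matrix.mulVec (tensorOp fun v => cliffordMat (C v)) (graphState G)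

/-! ### The simulator register -/

/-- The data stored by the simulator: a graph and the vertex operators (VOPs), the latter modulo
global phases. -/
structure GraphRegister (V : Type*) where
  graph : SimpleGraph V
  vop : V → LocalClifford

/-- The register `r` represents the vector `ψ`: up to a global phase, `ψ = |G; C⟩` for the graph
`G` of `r` and all choices `C` of representatives of its vertex operators. -/
def GraphRegister.Represents {V : Type*} [Fintype V] [DecidableEq V] (r : GraphRegister V)
    (ψ : QState V) : Prop :=
  ∀ C : V → cliffordOps, (∀ v, cliffordClass (C v) = r.vop v) →
    EqUpToPhase ψ (vopState r.graph C)

/-- The choice of the representatives only affects the global phase. -/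
theorem represents_vopState {V : Type*} [Fintype V] [DecidableEq V] (G : SimpleGraph V)
    (C : V → cliffordOps) :
    (⟨G, fun v => cliffordClass (C v)⟩ : GraphRegister V).Represents (vopState G C) := by
  intro C' hC'
  have h : ∀ v, ∃ z : ℂ, ‖z‖ = 1 ∧ cliffordMat (C v) = z • cliffordMat (C' v) := by
    intro v
    obtain ⟨z, hz⟩ : (C' v)⁻¹ * C v ∈ globalPhases := QuotientGroup.eq.1 (hC' v)
    refine ⟨z, ?_, ?_⟩
    · have h1 := Matrix.mem_unitaryGroup_iff.1 ((C' v)⁻¹ * C v).1.2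
      rw [hz] at h1
      have h2 := congrFun (congrFun h1 0) 0
      simp only [star_smul, star_one, Matrix.mul_smul, Matrix.smul_apply,
        Matrix.one_apply_eq, smul_eq_mul, mul_one] at h2
      have h3 : (‖z‖ : ℝ) ^ 2 = 1 := by
        have h4 : z * (starRingEnd ℂ) z = 1 := (mul_comm _ _).trans h2
        rw [Complex.mul_conj, Complex.normSq_eq_norm_sq] at h4
        exact_mod_cast h4
      exact (pow_eq_one_iff_of_nonneg (norm_nonneg z) two_ne_zero).1 h3
    · have h1 : C v = C' v * ((C' v)⁻¹ * C v) := by group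
      have h2 : cliffordMat (C v) = cliffordMat (C' v)
          * ((((C' v)⁻¹ * C v : cliffordOps) : Matrix.unitaryGroup (Fin 2) ℂ) : QMat) :=
        congrArg cliffordMat h1
      rw [h2, hz]
      simp
  choose z hz1 hz2 using h
  refine ⟨∏ v, z v, by simp [hz1], ?_⟩
  unfold vopState
  rw [← Matrix.smul_mulVec]
  congr 1
  ext x y
  simp [tensorOp, hz2, Finset.prod_mul_distrib]

/-- Local complementation `L_a` of a graph:
the edge set becomes `E ∆ {{b, c} | b, c ∈ ngbh a}` (loops being discarded). -/
def localComplement {V : Type*} (G : SimpleGraph V) (a : V) : SimpleGraph V :=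
  G ∆ SimpleGraph.fromEdgeSet
    {e | ∃ b ∈ G.neighborSet a, ∃ c ∈ G.neighborSet a, e = s(b, c)}

namespace GraphRegister

variable {V : Type*}

/-- Local complementation about `v` with the compensating update of the vertex operators. -/
def localComplementation (r : GraphRegister V) (v : V) : GraphRegister V where
  graph := localComplement r.graph v
  vop := open Classical in fun w =>
    if w = v then r.vop w * sqrtIX
    else if r.graph.Adj v w then r.vop w * sqrtNegIZ
    else r.vop w

/-- Toggling the edge `{a, b}`. -/
def toggleEdge (r : GraphRegister V) (a b : V) : GraphRegister V where
  graph := r.graph ∆ SimpleGraph.edge a b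
  vop := r.vop

/-- The neighbours of `a` other than `b`. -/
def otherNeighbors (r : GraphRegister V) (a b : V) : Set V := r.graph.neighborSet a \ {b}

end GraphRegister

/-! ### The two lookup tables -/

/-- The two factors used in decompositions of local Clifford operators. -/
inductive CliffordFactor where
  | negIX
  | posIZ

/-- `negIX` stands for `√(-iX)` and `posIZ` for `√(iZ)`. -/
def CliffordFactor.val : CliffordFactor → LocalClifford
  | negIX => sqrtNegIX
  | posIZ => sqrtIZ

/-- `D` spells out every local Clifford operator as a product of at most 5 factors `√(-iX)` and
`√(iZ)`, up to a global phase. -/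
def IsDecompositionTable (D : LocalClifford → List CliffordFactor) : Prop :=
  ∀ C, (D C).length ≤ 5 ∧ ((D C).map CliffordFactor.val).prod = C

/-- The register on two qubits with given VOPs, with an edge iff `e` is true. -/
def twoQubitRegister (e : Bool) (C₁ C₂ : LocalClifford) : GraphRegister (Fin 2) where
  graph := if e then ⊤ else ⊥
  vop := ![C₁, C₂]

/-- Candidates for the lookup table of the phase gate on two qubits: a line maps the edge bit and
the two VOPs to the new edge bit and the two new VOPs. -/
abbrev PhaseTable := Bool → LocalClifford → LocalClifford → Bool × LocalClifford × LocalClifford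

/-- Every line of the table is correct: it describes the action of `ΛZ` on the two-qubit state. -/
def PhaseTable.IsCorrect (T : PhaseTable) : Prop :=
  ∀ (e : Bool) (C₁ C₂ : LocalClifford) (ψ : QState (Fin 2)),
    (twoQubitRegister e C₁ C₂).Represents ψ →
      (twoQubitRegister (T e C₁ C₂).1 (T e C₁ C₂).2.1 (T e C₁ C₂).2.2).Represents
        (Matrix.mulVec (controlledZ 0 1) ψ)

/-- A VOP in `𝒵` is sent to a VOP in `𝒵`, for each of the two vertices. -/
def PhaseTable.PreservesZ (T : PhaseTable) : Prop :=
  ∀ (e : Bool) (C₁ C₂ : LocalClifford),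
    (C₁ ∈ zSet → (T e C₁ C₂).2.1 ∈ zSet) ∧ (C₂ ∈ zSet → (T e C₁ C₂).2.2 ∈ zSet)

/-! ### The procedures -/

namespace GraphRegister

variable {V : Type*}

/-- The successive centres of the local complementations that reduce the VOP of `a` with swapping
partner `c`: the decomposition of the VOP is read from right to left, `√(-iX)` giving the
centre `a` and `√(iZ)` the centre `c`. -/
def reductionCenters (D : LocalClifford → List CliffordFactor) (r : GraphRegister V) (a c : V) :
    List V :=
  (D (r.vop a)).reverse.map fun f =>
    match f with
    | CliffordFactor.negIX => a
    | CliffordFactor.posIZ => c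

/-- The reduction of the VOP of `a` with swapping partner `c`. -/
def reduceVOP (D : LocalClifford → List CliffordFactor) (r : GraphRegister V) (a c : V) :
    GraphRegister V :=
  (r.reductionCenters D a c).foldl localComplementation r

/-- `remove_VOP(a, b)` may turn `r` into `r'`: the swapping partner `c` is any neighbour of `a`
other than `b` if there is one, and `b` otherwise. -/
def RemoveVOP (D : LocalClifford → List CliffordFactor) (a b : V) (r r' : GraphRegister V) :
    Prop :=
  ∃ c, ((r.otherNeighbors a b).Nonempty ∧ c ∈ r.otherNeighbors a b ∨
      r.otherNeighbors a b = ∅ ∧ c = b) ∧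
    r' = r.reduceVOP D a c

/-- `if ngbh a \ {b} ≠ {} then remove_VOP(a, b)` may turn `r` into `r'`. -/
def TryRemoveVOP (D : LocalClifford → List CliffordFactor) (a b : V) (r r' : GraphRegister V) :
    Prop :=
  (r.otherNeighbors a b).Nonempty ∧ RemoveVOP D a b r r' ∨
    r.otherNeighbors a b = ∅ ∧ r' = r

/-- The first part of `cphase(a, b)`, before the table lookup, may turn `r` into `r'`. -/
def PrepareCPhase (D : LocalClifford → List CliffordFactor) (a b : V) (r r' : GraphRegister V) :
    Prop :=
  ∃ r₁ r₂, TryRemoveVOP D a b r r₁ ∧ TryRemoveVOP D b a r₁ r₂ ∧ TryRemoveVOP D a b r₂ r'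

/-- Each operand vertex has no non-operand neighbour or has its VOP in `𝒵`. -/
def ReadyForLookup (r : GraphRegister V) (a b : V) : Prop :=
  (r.otherNeighbors a b = ∅ ∨ r.vop a ∈ zSet) ∧ (r.otherNeighbors b a = ∅ ∨ r.vop b ∈ zSet)

/-- The table lookup: replace the edge bit of `{a, b}` and the VOPs of `a` and `b` as told by `T`,
leaving everything else unchanged. -/
def lookupCPhase (T : PhaseTable) (a b : V) (r : GraphRegister V) : GraphRegister V :=
  open Classical in
  let line := T (decide (r.graph.Adj a b)) (r.vop a) (r.vop b)
  { graph := (r.graph \ SimpleGraph.edge a b) ⊔ (if line.1 then SimpleGraph.edge a b else ⊥)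
    vop := Function.update (Function.update r.vop a line.2.1) b line.2.2 }

/-- `cphase(a, b)` may turn `r` into `r'` (the choices are those of the swapping partners). -/
def CPhase (D : LocalClifford → List CliffordFactor) (T : PhaseTable) (a b : V)
    (r r' : GraphRegister V) : Prop :=
  ∃ r₁, PrepareCPhase D a b r r₁ ∧ r' = lookupCPhase T a b r₁

end GraphRegister

end

/-!
Modulo phases, a local Clifford operator is determined by the signed Pauli matrices into which it
conjugates `X` and `Z`. Statements about single vertex operators are thereby finite; in particular
`𝒵` consists of the operators fixing `Z`, which are the diagonal ones and commute with `ΛZ`.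

Up to a constant factor, the amplitudes of a graph state are signs. When `a` has `k` neighbours
carrying a one, local complementation about `a` multiplies the sign by `(-1) ^ (k choose 2)`, and
this is exactly what `√(iX)` at `a` and `√(-iZ)` at the neighbours of `a` compensate. Hence the
reduction of a vertex operator does not change the state.

If each of `a` and `b` has a diagonal vertex operator or no neighbour besides the other one, then
every amplitude is a two-qubit amplitude on `{a, b}` times a factor that depends neither on the edge
`{a, b}` nor on the vertex operators of `a` and `b`, and the table lookup becomes a statement on two
qubits.

For two qubits, local complementations about `a` make the vertex operator of `a` diagonal unless it
conjugates `X` into `±Z`. In that case, provided that `b` is not adjacent to `a` or has a diagonal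
vertex operator, `±Z_a` or `±Z_a Z_b` stabilizes the state. So `x_a` is determined by `x_b` on the
support, and `ΛZ` acts as a power of `Z_b`. Otherwise it toggles the edge. Neither takes a vertex
operator out of `𝒵`.
-/

noncomputable section

/-! ### Clifford operators acting on signed Pauli matrices -/

/-- The labels of the matrices `±X, ±Y, ±Z`: the letters are `0, 1, 2`, and `true` is the sign `-`.
The type is concrete, so that statements about all labels can be decided. -/
abbrev PauliLabel := Fin 3 × Bool

namespace PauliLabel

/-- The label of `X`. -/
abbrev X : PauliLabel := (0, false)

/-- The label of `Z`. -/
abbrev Z : PauliLabel := (2, false)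

/-- The label of the matrix with the opposite sign. -/
def neg (s : PauliLabel) : PauliLabel := (s.1, !s.2)

/-- The signed Pauli matrix with a given label. -/
def matrix (s : PauliLabel) : QMat :=
  (if s.2 then (-1 : ℂ) else 1) • ![pauliX, pauliY, pauliZ] s.1

theorem matrix_neg (s : PauliLabel) : s.neg.matrix = -s.matrix := by
  obtain ⟨i, t⟩ := s
  cases t <;> simp [matrix, neg]

theorem matrix_mul_self (s : PauliLabel) : s.matrix * s.matrix = 1 := by
  obtain ⟨i, t⟩ := s
  ext k l
  fin_cases i <;> cases t <;> fin_cases k <;> fin_cases l <;>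
    simp [matrix, pauliX, pauliY, pauliZ, Matrix.mul_apply]

theorem star_matrix (s : PauliLabel) : star s.matrix = s.matrix := by
  obtain ⟨i, t⟩ := s
  ext k l
  fin_cases i <;> cases t <;> fin_cases k <;> fin_cases l <;>
    simp [matrix, pauliX, pauliY, pauliZ]

theorem matrix_injective : Function.Injective matrix := by
  rintro ⟨i, s⟩ ⟨j, t⟩ h
  have h00 := congrFun (congrFun h 0) 0
  have h01 := congrFun (congrFun h 0) 1
  have h10 := congrFun (congrFun h 1) 0
  fin_cases i <;> fin_cases j <;> cases s <;> cases t <;>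
    simp_all [matrix, pauliX, pauliY, pauliZ, Complex.ext_iff, neg_eq_iff_add_eq_zero,
      one_add_one_eq_two, eq_neg_iff_add_eq_zero]

theorem matrix_ne_smul_one (s : PauliLabel) (z : ℂ) : s.matrix ≠ z • 1 := by
  obtain ⟨i, t⟩ := s
  intro h
  have h00 := congrFun (congrFun h 0) 0
  have h01 := congrFun (congrFun h 0) 1
  have h11 := congrFun (congrFun h 1) 1
  fin_cases i <;> cases t <;>
    simp [matrix, pauliX, pauliY, pauliZ] at h00 h01 h11 <;> grind

/-- A signed Pauli matrix as a unitary. -/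
def unitary (s : PauliLabel) : Matrix.unitaryGroup (Fin 2) ℂ :=
  ⟨s.matrix, by rw [Matrix.mem_unitaryGroup_iff, star_matrix, matrix_mul_self]⟩

theorem unitary_mem_pauliGroup (s : PauliLabel) : s.unitary ∈ pauliGroup := by
  obtain ⟨i, t⟩ := s
  refine ⟨if t then -1 else 1, by cases t <;> simp, ![pauliX, pauliY, pauliZ] i, ?_, rfl⟩
  fin_cases i <;> simp

/-- Being an involution excludes the factors `±i`. -/
theorem exists_matrix_eq {P : Matrix.unitaryGroup (Fin 2) ℂ} (hP : P ∈ pauliGroup)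
    (hPP : (P : QMat) * P = 1) (hP1 : ∀ z : ℂ, (P : QMat) ≠ z • 1) :
    ∃ s : PauliLabel, s.matrix = P := by
  obtain ⟨c, -, σ, hσ, hPσ⟩ := hP
  obtain ⟨i, rfl⟩ : ∃ i, σ = PauliLabel.matrix (i, false) := by
    rcases hσ with rfl | rfl | rfl | rfl
    exacts [absurd hPσ (hP1 c), ⟨0, by simp [matrix]⟩, ⟨1, by simp [matrix]⟩,
      ⟨2, by simp [matrix]⟩]
  have hc : c * c = 1 := by
    rw [hPσ, Matrix.smul_mul, Matrix.mul_smul, smul_smul, matrix_mul_self] at hPP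
    simpa using congrFun (congrFun hPP 0) 0
  rcases mul_self_eq_one_iff.1 hc with rfl | rfl
  · exact ⟨(i, false), by simp [hPσ]⟩
  · exact ⟨(i, true), by simp [hPσ, matrix]⟩

end PauliLabel

theorem cliffordMat_mul (U W : cliffordOps) :
    cliffordMat (U * W) = cliffordMat U * cliffordMat W := rfl

theorem cliffordMat_mul_inv (U : cliffordOps) : cliffordMat U * cliffordMat U⁻¹ = 1 := by
  rw [← cliffordMat_mul, mul_inv_cancel]; rfl

theorem cliffordMat_inv_mul (U : cliffordOps) : cliffordMat U⁻¹ * cliffordMat U = 1 := by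
  rw [← cliffordMat_mul, inv_mul_cancel]; rfl

theorem cliffordClass_surjective : Function.Surjective cliffordClass :=
  QuotientGroup.mk_surjective

theorem exists_cliffordMat_eq_smul {U W : cliffordOps} (h : cliffordClass U = cliffordClass W) :
    ∃ z : ℂ, cliffordMat W = z • cliffordMat U := by
  obtain ⟨z, hz⟩ : U⁻¹ * W ∈ globalPhases := QuotientGroup.eq.1 h
  refine ⟨z, ?_⟩
  change cliffordMat (U⁻¹ * W) = z • 1 at hz
  rw [← mul_inv_cancel_left U W, cliffordMat_mul, hz, Matrix.mul_smul, mul_one]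

/-- Conjugation with `C` sends the signed Pauli matrix `s` to `t`. By `mapsPauli_cliffordClass`
the choice of the representative does not matter. -/
def MapsPauli (C : LocalClifford) (s t : PauliLabel) : Prop :=
  ∃ U, cliffordClass U = C ∧ cliffordMat U * s.matrix = t.matrix * cliffordMat U

theorem mapsPauli_cliffordClass {U : cliffordOps} {s t : PauliLabel} :
    MapsPauli (cliffordClass U) s t ↔
      cliffordMat U * s.matrix = t.matrix * cliffordMat U := by
  refine ⟨?_, fun h => ⟨U, rfl, h⟩⟩
  rintro ⟨W, hW, h⟩
  obtain ⟨z, hz⟩ := exists_cliffordMat_eq_smul hW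
  rw [hz, Matrix.smul_mul, Matrix.mul_smul, h]

namespace MapsPauli

variable {C C' : LocalClifford} {s t t' u p q : PauliLabel}

theorem one (s : PauliLabel) : MapsPauli 1 s s :=
  ⟨1, rfl, by change 1 * _ = _ * 1; rw [one_mul, mul_one]⟩

theorem mul (h : MapsPauli C t u) (h' : MapsPauli C' s t) : MapsPauli (C * C') s u := by
  obtain ⟨U, rfl, hU⟩ := h
  obtain ⟨W, rfl, hW⟩ := h'
  refine ⟨U * W, rfl, ?_⟩
  rw [cliffordMat_mul, mul_assoc, hW, ← mul_assoc, hU, mul_assoc]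

theorem inv (h : MapsPauli C s t) : MapsPauli C⁻¹ t s := by
  obtain ⟨U, rfl, hU⟩ := h
  refine ⟨U⁻¹, rfl, ?_⟩
  calc cliffordMat U⁻¹ * t.matrix
      = cliffordMat U⁻¹ * (t.matrix * cliffordMat U) * cliffordMat U⁻¹ := by
        rw [mul_assoc, mul_assoc, cliffordMat_mul_inv, mul_one]
    _ = s.matrix * cliffordMat U⁻¹ := by
        rw [← hU, ← mul_assoc, cliffordMat_inv_mul, one_mul]

theorem neg (h : MapsPauli C s t) : MapsPauli C s.neg t.neg := by
  obtain ⟨U, rfl, hU⟩ := h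
  exact ⟨U, rfl, by rw [s.matrix_neg, t.matrix_neg, mul_neg, neg_mul, hU]⟩

theorem eq_of_one (h : MapsPauli 1 s t) : s = t := by
  have h' := mapsPauli_cliffordClass (U := 1).1 h
  change 1 * _ = _ * 1 at h'
  rw [one_mul, mul_one] at h'
  exact PauliLabel.matrix_injective h'

theorem right_unique (h : MapsPauli C s t) (h' : MapsPauli C s t') : t = t' :=
  eq_of_one (mul_inv_cancel C ▸ h'.mul h.inv)

/-- `X` and `Z` anticommute, so that their images are different Pauli matrices even up to sign. -/
theorem fst_ne (hX : MapsPauli C .X p) (hZ : MapsPauli C .Z q) : p.1 ≠ q.1 := by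
  intro hpq
  have hpq_neg : p = q ∨ p = q.neg :=
    (Bool.eq_or_eq_not p.2 q.2).imp (Prod.ext hpq) (Prod.ext hpq)
  rcases hpq_neg with rfl | rfl
  · exact absurd (hX.inv.right_unique hZ.inv) (by decide)
  · exact absurd (hX.inv.right_unique hZ.inv.neg) (by decide)

theorem eq_one (hX : MapsPauli C .X .X) (hZ : MapsPauli C .Z .Z) : C = 1 := by
  obtain ⟨U, rfl⟩ := cliffordClass_surjective C
  rw [mapsPauli_cliffordClass] at hX hZ
  refine (QuotientGroup.eq_one_iff _).2 ⟨cliffordMat U 0 0, ?_⟩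
  change cliffordMat U = _
  have hX01 := congrFun (congrFun hX 0) 1
  have hZ01 := congrFun (congrFun hZ 0) 1
  have hZ10 := congrFun (congrFun hZ 1) 0
  simp only [PauliLabel.matrix, pauliX, pauliZ, Matrix.mul_apply] at hX01 hZ01 hZ10
  ext k l
  fin_cases k <;> fin_cases l <;> simp at hX01 hZ01 hZ10 ⊢ <;> grind

theorem ext (hX : MapsPauli C .X p) (hZ : MapsPauli C .Z q) (hX' : MapsPauli C' .X p)
    (hZ' : MapsPauli C' .Z q) : C = C' :=
  (inv_mul_eq_one.1 (eq_one (hX'.inv.mul hX) (hZ'.inv.mul hZ))).symm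

end MapsPauli

theorem exists_mapsPauli (C : LocalClifford) (s : PauliLabel) : ∃ t, MapsPauli C s t := by
  obtain ⟨U, rfl⟩ := cliffordClass_surjective C
  have hmem : U * s.unitary * (U : Matrix.unitaryGroup (Fin 2) ℂ)⁻¹ ∈ pauliGroup :=
    (U.2 _).1 s.unitary_mem_pauliGroup
  have hval : ((U * s.unitary * (U : Matrix.unitaryGroup (Fin 2) ℂ)⁻¹ :
      Matrix.unitaryGroup (Fin 2) ℂ) : QMat) = cliffordMat U * s.matrix * cliffordMat U⁻¹ := rfl
  have hinv := cliffordMat_inv_mul U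
  have hinvol : cliffordMat U * s.matrix * cliffordMat U⁻¹
      * (cliffordMat U * s.matrix * cliffordMat U⁻¹) = 1 := by
    grind [s.matrix_mul_self, cliffordMat_mul_inv U]
  have hscalar : ∀ z : ℂ, cliffordMat U * s.matrix * cliffordMat U⁻¹ ≠ z • 1 := by
    intro z hz
    refine s.matrix_ne_smul_one z ?_
    calc s.matrix = cliffordMat U⁻¹ * (cliffordMat U * s.matrix * cliffordMat U⁻¹)
          * cliffordMat U := by grind
      _ = z • 1 := by rw [hz, Matrix.mul_smul, Matrix.smul_mul, mul_one, hinv]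
  obtain ⟨t, ht⟩ := PauliLabel.exists_matrix_eq hmem hinvol hscalar
  exact ⟨t, U, rfl, by rw [ht, hval, mul_assoc, hinv, mul_one]⟩

/-! ### Words in the Clifford factors -/

instance : DecidableEq CliffordFactor
  | .negIX, .negIX | .posIZ, .posIZ => isTrue rfl
  | .negIX, .posIZ | .posIZ, .negIX => isFalse nofun

/-- The action of a Clifford factor on signed Pauli matrices, see `CliffordFactor.mapsPauli`. -/
def CliffordFactor.conj : CliffordFactor → PauliLabel → PauliLabel
  | .negIX, (0, s) => (0, s)
  | .negIX, (1, s) => (2, s)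
  | .negIX, (2, s) => (1, !s)
  | .posIZ, (0, s) => (1, !s)
  | .posIZ, (1, s) => (0, s)
  | .posIZ, (2, s) => (2, s)

theorem CliffordFactor.mapsPauli (f : CliffordFactor) (s : PauliLabel) :
    MapsPauli f.val s (f.conj s) := by
  obtain ⟨i, t⟩ := s
  have hI := Complex.I_mul_I
  cases f
  · refine MapsPauli.inv (C := sqrtIX) (mapsPauli_cliffordClass.2 ?_)
    change sqrtIXMat * _ = _ * sqrtIXMat
    rw [sqrtIXMat_eq]
    ext k l
    fin_cases i <;> cases t <;> fin_cases k <;> fin_cases l <;>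
      simp [PauliLabel.matrix, conj, pauliX, pauliY, pauliZ, Matrix.mul_apply] <;> grind
  · refine MapsPauli.inv (C := sqrtNegIZ) (mapsPauli_cliffordClass.2 ?_)
    change sqrtNegIZMat * _ = _ * sqrtNegIZMat
    rw [sqrtNegIZMat_eq]
    ext k l
    fin_cases i <;> cases t <;> fin_cases k <;> fin_cases l <;>
      simp [PauliLabel.matrix, conj, pauliX, pauliY, pauliZ, Matrix.mul_apply] <;> grind

/-- The action of a word in the Clifford factors on signed Pauli matrices, see
`mapsPauli_conjWord`. -/
def conjWord (w : List CliffordFactor) (s : PauliLabel) : PauliLabel :=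
  w.foldr CliffordFactor.conj s

theorem mapsPauli_conjWord (w : List CliffordFactor) (s : PauliLabel) :
    MapsPauli (w.map CliffordFactor.val).prod s (conjWord w s) := by
  induction w with
  | nil => exact .one s
  | cons f w ih => simpa [conjWord] using (f.mapsPauli _).mul ih

/-- The list of all words of length at most `n` in the Clifford factors, for use with `decide`. -/
def wordsUpTo : ℕ → List (List CliffordFactor)
  | 0 => [[]]
  | n + 1 => [] :: (wordsUpTo n).flatMap fun w => [.negIX :: w, .posIZ :: w]

theorem mem_wordsUpTo {n : ℕ} {w : List CliffordFactor} : w ∈ wordsUpTo n ↔ w.length ≤ n := by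
  induction n generalizing w with
  | zero => simp [wordsUpTo]
  | succ n ih =>
    rcases w with _ | ⟨_ | _, w⟩ <;> simp [wordsUpTo, ih]

set_option maxRecDepth 100000 in
theorem exists_mem_wordsUpTo_conjWord_eq : ∀ p q : PauliLabel, p.1 ≠ q.1 →
    ∃ w ∈ wordsUpTo 5, conjWord w .X = p ∧ conjWord w .Z = q := by
  decide

theorem exists_isDecompositionTable : ∃ D, IsDecompositionTable D := by
  suffices ∀ C, ∃ w : List CliffordFactor,
      w.length ≤ 5 ∧ (w.map CliffordFactor.val).prod = C from Classical.skolem.1 this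
  intro C
  obtain ⟨p, hp⟩ := exists_mapsPauli C .X
  obtain ⟨q, hq⟩ := exists_mapsPauli C .Z
  obtain ⟨w, hw, rfl, rfl⟩ := exists_mem_wordsUpTo_conjWord_eq p q (hp.fst_ne hq)
  exact ⟨w, mem_wordsUpTo.1 hw, MapsPauli.ext (mapsPauli_conjWord w _) (mapsPauli_conjWord w _)
    hp hq⟩

set_option maxRecDepth 100000 in
theorem eq_nil_or_replicate_of_conjWord_eq : ∀ w ∈ wordsUpTo 5,
    conjWord w .X = .X → conjWord w .Z = .Z →
    w = [] ∨ w = List.replicate 4 .negIX ∨ w = List.replicate 4 .posIZ := by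
  decide

theorem eq_nil_or_replicate_of_prod_eq_one {w : List CliffordFactor} (hw : w.length ≤ 5)
    (h : (w.map CliffordFactor.val).prod = 1) : w = [] ∨ ∃ f, w = List.replicate 4 f := by
  have hconj : ∀ s, conjWord w s = s := fun s => (h ▸ mapsPauli_conjWord w s).eq_of_one.symm
  rcases eq_nil_or_replicate_of_conjWord_eq w (mem_wordsUpTo.2 hw) (hconj _) (hconj _) with
    h | h | h
  exacts [.inl h, .inr ⟨_, h⟩, .inr ⟨_, h⟩]

/-! ### The diagonal Clifford operators -/

theorem mapsPauli_phaseOp_X : MapsPauli (cliffordClass phaseOp) .X (1, false) := by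
  refine mapsPauli_cliffordClass.2 ?_
  change phaseMat * _ = _ * phaseMat
  ext i j
  fin_cases i <;> fin_cases j <;>
    simp [phaseMat, PauliLabel.matrix, pauliX, pauliY, Matrix.mul_apply]

theorem mapsPauli_phaseOp_Y : MapsPauli (cliffordClass phaseOp) (1, false) (0, true) := by
  refine mapsPauli_cliffordClass.2 ?_
  change phaseMat * _ = _ * phaseMat
  ext i j
  fin_cases i <;> fin_cases j <;>
    simp [phaseMat, PauliLabel.matrix, pauliX, pauliY, Matrix.mul_apply]

theorem mapsPauli_phaseOp_Z : MapsPauli (cliffordClass phaseOp) .Z .Z := by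
  refine mapsPauli_cliffordClass.2 ?_
  change phaseMat * _ = _ * phaseMat
  ext i j
  fin_cases i <;> fin_cases j <;> simp [phaseMat, PauliLabel.matrix, pauliZ, Matrix.mul_apply]

theorem mapsPauli_zOp_X : MapsPauli (cliffordClass zOp) .X (0, true) := by
  refine mapsPauli_cliffordClass.2 ?_
  change pauliZ * _ = _ * pauliZ
  ext i j
  fin_cases i <;> fin_cases j <;> simp [PauliLabel.matrix, pauliX, pauliZ, Matrix.mul_apply]

theorem mapsPauli_zOp_Z : MapsPauli (cliffordClass zOp) .Z .Z :=
  mapsPauli_cliffordClass.2 (by change pauliZ * _ = _ * pauliZ; simp [PauliLabel.matrix])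

theorem mem_zSet_iff {C : LocalClifford} : C ∈ zSet ↔ MapsPauli C .Z .Z := by
  constructor
  · rintro (rfl | rfl | rfl | rfl)
    exacts [.one _, mapsPauli_zOp_Z, mapsPauli_phaseOp_Z, mapsPauli_phaseOp_Z.inv]
  · intro hZ
    obtain ⟨⟨i, s⟩, hX⟩ := exists_mapsPauli C .X
    have hi : i ≠ 2 := hX.fst_ne hZ
    fin_cases i <;> cases s
    · exact .inl (hX.eq_one hZ)
    · exact .inr (.inl (hX.ext hZ mapsPauli_zOp_X mapsPauli_zOp_Z))
    · exact .inr (.inr (.inl (hX.ext hZ mapsPauli_phaseOp_X mapsPauli_phaseOp_Z)))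
    · exact .inr (.inr (.inr (hX.ext hZ mapsPauli_phaseOp_Y.neg.inv mapsPauli_phaseOp_Z.inv)))
    all_goals exact absurd rfl hi

theorem one_mem_zSet : 1 ∈ zSet := mem_zSet_iff.2 (.one _)

theorem mul_mem_zSet {C C' : LocalClifford} (h : C ∈ zSet) (h' : C' ∈ zSet) : C * C' ∈ zSet :=
  mem_zSet_iff.2 ((mem_zSet_iff.1 h).mul (mem_zSet_iff.1 h'))

theorem cliffordClass_zOp_mem_zSet : cliffordClass zOp ∈ zSet := mem_zSet_iff.2 mapsPauli_zOp_Z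

theorem sqrtNegIZ_mem_zSet : sqrtNegIZ ∈ zSet :=
  mem_zSet_iff.2 (inv_inv sqrtNegIZ ▸ (CliffordFactor.posIZ.mapsPauli .Z).inv)

theorem cliffordMat_apply_eq_zero {U : cliffordOps} (h : cliffordClass U ∈ zSet)
    {i j : Fin 2} (hij : i ≠ j) : cliffordMat U i j = 0 := by
  have hZ := congrFun (congrFun (mapsPauli_cliffordClass.1 (mem_zSet_iff.1 h)) i) j
  simp only [PauliLabel.matrix, pauliZ, Matrix.mul_apply] at hZ
  fin_cases i <;> fin_cases j <;> simp at hij hZ ⊢ <;> grind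

/-- `C X C† = ±Z`. These are the operators that `√(iX)` cannot carry into `𝒵`. -/
def MapsXToZ (C : LocalClifford) : Prop := ∃ t, MapsPauli C .X (2, t)

theorem exists_conjWord_replicate_negIX_eq_Z : ∀ t : PauliLabel, t.1 ≠ 0 →
    ∃ k < 4, conjWord (List.replicate k .negIX) t = .Z := by
  decide

theorem mapsXToZ_or_exists_mul_sqrtIX_pow_mem_zSet (C : LocalClifford) :
    MapsXToZ C ∨ ∃ k : ℕ, C * sqrtIX ^ k ∈ zSet := by
  obtain ⟨⟨i, s⟩, hC⟩ := exists_mapsPauli C⁻¹ .Z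
  replace hC : MapsPauli C (i, s) .Z := by simpa using hC.inv
  by_cases hi : i = 0
  · subst hi
    cases s
    exacts [.inl ⟨false, hC⟩, .inl ⟨true, hC.neg⟩]
  · obtain ⟨k, -, hk⟩ := exists_conjWord_replicate_negIX_eq_Z (i, s) hi
    have hkZ : MapsPauli (sqrtIX ^ k) .Z (i, s) := by
      simpa [CliffordFactor.val, sqrtNegIX, hk] using
        (mapsPauli_conjWord (List.replicate k .negIX) (i, s)).inv
    exact .inr ⟨k, mem_zSet_iff.2 (hC.mul hkZ)⟩

/-! ### Graph states and vertex operators -/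

section GraphState

variable {V : Type*}

theorem EqUpToPhase.symm {φ ψ : QState V} (h : EqUpToPhase φ ψ) : EqUpToPhase ψ φ := by
  obtain ⟨z, hz, rfl⟩ := h
  have hz0 : z ≠ 0 := norm_ne_zero_iff.1 (hz ▸ one_ne_zero)
  exact ⟨z⁻¹, by simp [hz], by rw [smul_smul, inv_mul_cancel₀ hz0, one_smul]⟩

theorem EqUpToPhase.trans {φ ψ χ : QState V} (h : EqUpToPhase φ ψ) (h' : EqUpToPhase ψ χ) :
    EqUpToPhase φ χ := by
  obtain ⟨z, hz, rfl⟩ := h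
  obtain ⟨w, hw, rfl⟩ := h'
  exact ⟨z * w, by simp [hz, hw], by rw [smul_smul]⟩

theorem EqUpToPhase.mulVec [Fintype V] [DecidableEq V] {φ ψ : QState V} (h : EqUpToPhase φ ψ)
    (A : QOp V) : EqUpToPhase (A.mulVec φ) (A.mulVec ψ) := by
  obtain ⟨z, hz, rfl⟩ := h
  exact ⟨z, hz, Matrix.mulVec_smul _ _ _⟩

theorem tensorOp_mul [Fintype V] [DecidableEq V] (A B : V → QMat) :
    tensorOp A * tensorOp B = tensorOp fun v => A v * B v := by
  ext x y
  simp only [tensorOp, Matrix.mul_apply, Matrix.of_apply, ← Finset.prod_mul_distrib]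
  exact (Fintype.prod_sum fun v j => A v (x v) j * B v j (y v)).symm

theorem tensorOp_mulVec_of_offDiag_eq_zero [Fintype V] [DecidableEq V] {A : V → QMat} {a : V}
    (hA : ∀ v ≠ a, ∀ i j, i ≠ j → A v i j = 0) (ψ : QState V) (x : V → Fin 2) :
    (tensorOp A).mulVec ψ x = (∏ v ∈ Finset.univ.erase a, A v (x v) (x v)) *
      ∑ i, A a (x a) i * ψ (Function.update x a i) := by
  rw [Finset.mul_sum]
  refine (Fintype.sum_of_injective (Function.update x a) (Function.update_injective x a) _
    (fun y => (∏ v, A v (x v) (y v)) * ψ y) (fun y hy => ?_) fun i => ?_).symm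
  · obtain ⟨v, hva, hv⟩ : ∃ v ≠ a, x v ≠ y v := by
      by_contra! hxy
      refine hy ⟨y a, funext fun v => ?_⟩
      rcases eq_or_ne v a with rfl | hva
      · rw [Function.update_self]
      · rw [Function.update_of_ne hva, hxy v hva]
    rw [Finset.prod_eq_zero (Finset.mem_univ v) (hA v hva _ _ hv), zero_mul]
  · have hprod : ∏ v ∈ Finset.univ.erase a, A v (x v) (Function.update x a i v)
        = ∏ v ∈ Finset.univ.erase a, A v (x v) (x v) :=
      Finset.prod_congr rfl fun v hv => by
        rw [Function.update_of_ne (Finset.ne_of_mem_erase hv)]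
    change _ = (∏ v, A v (x v) (Function.update x a i v)) * ψ (Function.update x a i)
    rw [← Finset.mul_prod_erase _ _ (Finset.mem_univ a), hprod, Function.update_self]
    ring

/-- The sign of the amplitude at `x` in the graph state of `G`. -/
def graphSign [Fintype V] [DecidableEq V] (G : SimpleGraph V) (x : V → Fin 2) : ℂ :=
  open Classical in ∏ e ∈ G.edgeFinset, czSign e x

theorem graphState_eq_smul_graphSign [Fintype V] [DecidableEq V] (G : SimpleGraph V) :
    graphState G = ((Real.sqrt 2 : ℝ) : ℂ)⁻¹ ^ Fintype.card V • graphSign G :=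
  funext fun x => (graphState_apply G x).trans (mul_comm _ _)

theorem vopState_eq_smul [Fintype V] [DecidableEq V] (G : SimpleGraph V)
    (C : V → cliffordOps) :
    vopState G C = ((Real.sqrt 2 : ℝ) : ℂ)⁻¹ ^ Fintype.card V •
      (tensorOp fun v => cliffordMat (C v)).mulVec (graphSign G) := by
  rw [vopState, graphState_eq_smul_graphSign, Matrix.mulVec_smul]

theorem czSign_mul_self (e : Sym2 V) (x : V → Fin 2) : czSign e x * czSign e x = 1 := by
  unfold czSign
  split_ifs <;> simp

theorem czSign_mk (a b : V) (x : V → Fin 2) :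
    czSign s(a, b) x = if x a = 1 ∧ x b = 1 then -1 else 1 := by
  simp [czSign]

section Sign

variable [Fintype V] [DecidableEq V]

theorem graphSign_eq_prod_univ (G : SimpleGraph V) (x : V → Fin 2) :
    graphSign G x = open Classical in ∏ e, if e ∈ G.edgeSet then czSign e x else 1 := by
  classical
  rw [graphSign, ← Finset.prod_filter]
  exact Finset.prod_congr (by ext; simp) fun _ _ => rfl

theorem graphSign_symmDiff (G H : SimpleGraph V) (x : V → Fin 2) :
    graphSign (G ∆ H) x = graphSign G x * graphSign H x := by
  simp only [graphSign_eq_prod_univ, ← Finset.prod_mul_distrib]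
  refine Finset.prod_congr rfl fun e _ => ?_
  have hmem : e ∈ (G ∆ H).edgeSet ↔
      e ∈ G.edgeSet ∧ e ∉ H.edgeSet ∨ e ∈ H.edgeSet ∧ e ∉ G.edgeSet := by
    induction e with
    | _ p q => simp [symmDiff_def]
  by_cases hG : e ∈ G.edgeSet <;> by_cases hH : e ∈ H.edgeSet <;>
    simp [hmem, hG, hH, czSign_mul_self]

theorem graphSign_edge {a b : V} (hab : a ≠ b) (x : V → Fin 2) :
    graphSign (SimpleGraph.edge a b) x = czSign s(a, b) x := by
  simp [graphSign_eq_prod_univ, SimpleGraph.edgeSet_edge_of_ne hab]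

theorem graphSign_bot (x : V → Fin 2) : graphSign (⊥ : SimpleGraph V) x = 1 := by
  simp [graphSign_eq_prod_univ]

theorem graphSign_eq_neg_one_pow (G : SimpleGraph V) (x : V → Fin 2) :
    graphSign G x =
      (-1) ^ (open Classical in Finset.card {e ∈ G.edgeFinset | ∀ v ∈ e, x v = 1}) := by
  classical
  rw [graphSign, ← Finset.prod_const, Finset.prod_filter]
  exact Finset.prod_congr rfl fun e _ => by unfold czSign; congr

/-- For the complete graph on `N`, the pairs contributing a sign are those of two ones in `N`. -/
theorem graphSign_fromEdgeSet_pairs (N : Set V) (x : V → Fin 2) :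
    graphSign (SimpleGraph.fromEdgeSet {e | ∃ b ∈ N, ∃ c ∈ N, e = s(b, c)}) x =
      (-1) ^ (open Classical in Finset.card {v | v ∈ N ∧ x v = 1}).choose 2 := by
  classical
  rw [graphSign_eq_neg_one_pow, ← Sym2.card_image_offDiag]
  congr 2
  ext e
  induction e with
  | _ p q =>
    simp only [Finset.mem_filter, SimpleGraph.mem_edgeFinset, SimpleGraph.mem_edgeSet,
      SimpleGraph.fromEdgeSet_adj, Set.mem_ofPred_eq, Sym2.mem_iff, Finset.mem_image,
      Finset.mem_offDiag, Finset.mem_univ, true_and, Prod.exists, Function.uncurry, Sym2.eq_iff,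
      forall_eq_or_imp, forall_eq]
    grind

theorem graphSign_update (G : SimpleGraph V) (a : V) (x : V → Fin 2) :
    graphSign G (Function.update x a (x a + 1)) =
      (-1) ^ (open Classical in Finset.card {v | G.Adj a v ∧ x v = 1}) * graphSign G x := by
  classical
  have hflip := prod_czSign_update G a x
  rw [← Finset.prod_filter, Finset.prod_const] at hflip
  rw [graphSign, graphSign, hflip, ← mul_assoc, ← mul_pow]
  simp

theorem graphState_symmDiff_edge (G : SimpleGraph V) {a b : V} (hab : a ≠ b) :
    graphState (G ∆ SimpleGraph.edge a b) = (controlledZ a b).mulVec (graphState G) := by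
  funext x
  simp only [graphState_eq_smul_graphSign, controlledZ, Matrix.mulVec_diagonal, Pi.smul_apply,
    smul_eq_mul, graphSign_symmDiff, graphSign_edge hab]
  ring

theorem controlledZ_comm (a b : V) : controlledZ a b = controlledZ b a := by
  rw [controlledZ, controlledZ, Sym2.eq_swap]

theorem controlledZ_mul_tensorOp {A : V → QMat} {a b : V}
    (ha : ∀ i j, i ≠ j → A a i j = 0) (hb : ∀ i j, i ≠ j → A b i j = 0) :
    controlledZ a b * tensorOp A = tensorOp A * controlledZ a b := by
  ext x y
  rw [controlledZ, Matrix.diagonal_mul, Matrix.mul_diagonal, tensorOp, Matrix.of_apply]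
  by_cases hxa : x a = y a
  · by_cases hxb : x b = y b
    · rw [czSign_mk, czSign_mk, hxa, hxb, mul_comm]
    · rw [Finset.prod_eq_zero (Finset.mem_univ b) (hb _ _ hxb), mul_zero, zero_mul]
  · rw [Finset.prod_eq_zero (Finset.mem_univ a) (ha _ _ hxa), mul_zero, zero_mul]

end Sign

namespace GraphRegister

theorem exists_representatives (r : GraphRegister V) :
    ∃ C : V → cliffordOps, ∀ v, cliffordClass (C v) = r.vop v :=
  Classical.skolem.1 fun v => cliffordClass_surjective (r.vop v)

variable [Fintype V] [DecidableEq V] {r : GraphRegister V} {ψ : QState V}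

theorem represents_of_eqUpToPhase {C : V → cliffordOps}
    (hC : ∀ v, cliffordClass (C v) = r.vop v) (h : EqUpToPhase ψ (vopState r.graph C)) :
    r.Represents ψ := by
  obtain ⟨G, f⟩ := r
  obtain rfl : (fun v => cliffordClass (C v)) = f := funext hC
  exact fun C' hC' => h.trans (represents_vopState G C C' hC')

theorem Represents.toggleEdge (h : r.Represents ψ) {a b : V} (hab : a ≠ b)
    (ha : r.vop a ∈ zSet) (hb : r.vop b ∈ zSet) :
    (r.toggleEdge a b).Represents ((controlledZ a b).mulVec ψ) := by
  intro C hC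
  have htoggle : vopState (r.graph ∆ SimpleGraph.edge a b) C
      = (controlledZ a b).mulVec (vopState r.graph C) := by
    rw [vopState, vopState, graphState_symmDiff_edge _ hab, Matrix.mulVec_mulVec,
      Matrix.mulVec_mulVec, controlledZ_mul_tensorOp]
    · exact fun _ _ => cliffordMat_apply_eq_zero ((hC a).symm ▸ ha)
    · exact fun _ _ => cliffordMat_apply_eq_zero ((hC b).symm ▸ hb)
  exact htoggle ▸ (h C hC).mulVec _

end GraphRegister

/-! ### Local complementation -/

theorem I_pow_mul_neg_one_pow_choose (k : ℕ) :
    Complex.I ^ k * (-1) ^ k.choose 2 * (1 + Complex.I * (-1) ^ k) = 1 + Complex.I := by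
  induction k using Nat.twoStepInduction with
  | zero => simp
  | one => simp; grind [Complex.I_mul_I]
  | more k ih _ =>
    have hchoose : (k + 2).choose 2 = k.choose 2 + (2 * k + 1) := by
      rw [Nat.choose_succ_succ' (k + 1) 1, Nat.choose_succ_succ' k 1]
      grind [Nat.choose_one_right]
    rw [← ih, hchoose, pow_add, pow_add, pow_add, pow_add, pow_mul]
    simp

theorem norm_sqrt_two_inv_mul_one_add_I :
    ‖((Real.sqrt 2 : ℝ) : ℂ)⁻¹ * (1 + Complex.I)‖ = 1 := by
  have hnorm : ‖(1 + Complex.I : ℂ)‖ = Real.sqrt 2 := by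
    simp [Complex.norm_def, Complex.normSq_apply, one_add_one_eq_two]
  rw [norm_mul, hnorm, norm_inv, Complex.norm_real, Real.norm_of_nonneg (Real.sqrt_nonneg 2)]
  exact inv_mul_cancel₀ (by positivity)

theorem norm_sqrt_two_inv_mul_one_sub_I :
    ‖((Real.sqrt 2 : ℝ) : ℂ)⁻¹ * (1 - Complex.I)‖ = 1 := by
  rw [← norm_sqrt_two_inv_mul_one_add_I, ← Complex.norm_conj]
  simp

/-- The local unitary that compensates a local complementation about `a`. -/
def localComplementationOp (G : SimpleGraph V) (a v : V) : cliffordOps :=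
  open Classical in if v = a then sqrtIXOp else if G.Adj a v then sqrtNegIZOp else 1

theorem GraphRegister.localComplementation_vop (r : GraphRegister V) (a v : V) :
    (r.localComplementation a).vop v =
      r.vop v * cliffordClass (localComplementationOp r.graph a v) := by
  simp only [localComplementation, localComplementationOp]
  split_ifs
  exacts [rfl, rfl, (mul_one _).symm]

theorem cliffordClass_localComplementationOp_mem_zSet (G : SimpleGraph V) {a v : V}
    (hv : v ≠ a) : cliffordClass (localComplementationOp G a v) ∈ zSet := by
  rw [localComplementationOp, if_neg hv]
  split_ifs
  exacts [sqrtNegIZ_mem_zSet, one_mem_zSet]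

theorem sum_sqrtIXMat_mul_update [DecidableEq V] (a : V) (x : V → Fin 2) (ψ : QState V) :
    ∑ i, sqrtIXMat (x a) i * ψ (Function.update x a i) =
      ((Real.sqrt 2 : ℝ) : ℂ)⁻¹ *
        (ψ x + Complex.I * ψ (Function.update x a (x a + 1))) := by
  have hself : ψ x = ψ (Function.update x a (x a)) := by rw [Function.update_eq_self]
  rw [hself]
  generalize x a = i
  rw [sqrtIXMat_eq]
  fin_cases i <;> simp <;> ring

section

variable [Fintype V] [DecidableEq V]

theorem prod_localComplementationOp (G : SimpleGraph V) (a : V) (x : V → Fin 2) :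
    ∏ v ∈ Finset.univ.erase a, cliffordMat (localComplementationOp G a v) (x v) (x v) =
      (((Real.sqrt 2 : ℝ) : ℂ)⁻¹ * (1 - Complex.I)) ^
          (open Classical in Finset.card {v | G.Adj a v}) *
        Complex.I ^ (open Classical in Finset.card {v | G.Adj a v ∧ x v = 1}) := by
  classical
  have hentry : ∀ v ≠ a, cliffordMat (localComplementationOp G a v) (x v) (x v) =
      (if G.Adj a v then ((Real.sqrt 2 : ℝ) : ℂ)⁻¹ * (1 - Complex.I) else 1) *
        if G.Adj a v ∧ x v = 1 then Complex.I else 1 := by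
    intro v hv
    by_cases hadj : G.Adj a v
    · simp only [localComplementationOp, hv, hadj, if_true, if_false, true_and]
      change sqrtNegIZMat (x v) (x v) = _
      rw [sqrtNegIZMat_eq]
      generalize x v = i
      fin_cases i
      · simp
      · simp; grind [Complex.I_mul_I]
    · simp only [localComplementationOp, hv, hadj, if_false, false_and, mul_one]
      exact Matrix.one_apply_eq _
  rw [Finset.prod_congr rfl fun v hv => hentry v (Finset.ne_of_mem_erase hv),
    Finset.prod_erase _ (by simp), Finset.prod_mul_distrib, ← Finset.prod_filter,
    ← Finset.prod_filter, Finset.prod_const, Finset.prod_const]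

theorem graphSign_localComplement (G : SimpleGraph V) (a : V) (x : V → Fin 2) :
    graphSign (localComplement G a) x = graphSign G x *
      (-1) ^ (open Classical in Finset.card {v | G.Adj a v ∧ x v = 1}).choose 2 := by
  rw [localComplement, graphSign_symmDiff, graphSign_fromEdgeSet_pairs]
  rfl

/-- The number `k` of neighbours of `a` carrying a one determines everything: with
`√(iX) = (I + iX)/√2`, flipping `a` contributes `(-1)^k`, the toggled pairs `(-1)^(k choose 2)` and
the operators `√(-iZ)` contribute `i^k` up to a constant phase. -/
theorem vopState_localComplement (G : SimpleGraph V) (a : V) :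
    EqUpToPhase (vopState (localComplement G a) (localComplementationOp G a)) (graphState G) := by
  classical
  refine ⟨((Real.sqrt 2 : ℝ) : ℂ)⁻¹ * (1 + Complex.I) *
    (((Real.sqrt 2 : ℝ) : ℂ)⁻¹ * (1 - Complex.I)) ^ Finset.card {v | G.Adj a v}, ?_, ?_⟩
  · rw [norm_mul, norm_pow, norm_sqrt_two_inv_mul_one_sub_I, norm_sqrt_two_inv_mul_one_add_I,
      one_pow, mul_one]
  funext x
  have hdiag : ∀ v ≠ a, ∀ i j, i ≠ j → cliffordMat (localComplementationOp G a v) i j = 0 :=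
    fun v hv i j => cliffordMat_apply_eq_zero (cliffordClass_localComplementationOp_mem_zSet G hv)
  have hcentre : cliffordMat (localComplementationOp G a a) = sqrtIXMat := by
    rw [localComplementationOp, if_pos rfl]; rfl
  have hcount : Finset.card {v | G.Adj a v ∧ Function.update x a (x a + 1) v = 1} =
      Finset.card {v | G.Adj a v ∧ x v = 1} := by
    congr 1
    ext v
    simp only [Finset.mem_filter_univ]
    exact and_congr_right fun hv => by rw [Function.update_of_ne hv.ne']
  simp only [vopState_eq_smul, graphState_eq_smul_graphSign, Pi.smul_apply, smul_eq_mul]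
  rw [tensorOp_mulVec_of_offDiag_eq_zero hdiag, hcentre, sum_sqrtIXMat_mul_update,
    prod_localComplementationOp, graphSign_localComplement, graphSign_localComplement, hcount,
    graphSign_update]
  set k := Finset.card {v | G.Adj a v ∧ x v = 1}
  linear_combination (((Real.sqrt 2 : ℝ) : ℂ)⁻¹) ^ Fintype.card V *
    (((Real.sqrt 2 : ℝ) : ℂ)⁻¹ * (1 - Complex.I)) ^ Finset.card {v | G.Adj a v} *
    ((Real.sqrt 2 : ℝ) : ℂ)⁻¹ * graphSign G x * I_pow_mul_neg_one_pow_choose k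

end

end GraphState

section LocalComplement

variable {V : Type*} (G : SimpleGraph V) (a : V)

theorem localComplement_adj {v w : V} :
    (localComplement G a).Adj v w ↔
      G.Adj v w ∧ ¬(G.Adj a v ∧ G.Adj a w) ∨ ¬G.Adj v w ∧ G.Adj a v ∧ G.Adj a w ∧ v ≠ w := by
  have hpair : (∃ b ∈ G.neighborSet a, ∃ c ∈ G.neighborSet a, s(v, w) = s(b, c)) ↔
      G.Adj a v ∧ G.Adj a w := by
    constructor
    · rintro ⟨b, hb, c, hc, h⟩
      rcases Sym2.eq_iff.1 h with ⟨rfl, rfl⟩ | ⟨rfl, rfl⟩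
      exacts [⟨hb, hc⟩, ⟨hc, hb⟩]
    · exact fun ⟨hv, hw⟩ => ⟨v, hv, w, hw, rfl⟩
  have hne : G.Adj v w → v ≠ w := SimpleGraph.Adj.ne
  simp only [localComplement, symmDiff_def, SimpleGraph.sup_adj, SimpleGraph.sdiff_adj,
    SimpleGraph.fromEdgeSet_adj, Set.mem_ofPred_eq, hpair]
  tauto

theorem localComplement_adj_center {v : V} : (localComplement G a).Adj a v ↔ G.Adj a v := by
  simp [localComplement_adj]

theorem localComplement_involutive :
    Function.Involutive fun G : SimpleGraph V => localComplement G a := by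
  intro G
  ext v w
  have hne : G.Adj v w → v ≠ w := SimpleGraph.Adj.ne
  rw [localComplement_adj, localComplement_adj_center, localComplement_adj_center,
    localComplement_adj]
  tauto

end LocalComplement

/-! ### Reduction of vertex operators -/

/-- The centre of the local complementation that cancels the letter `f` at the right end of the
vertex operator of `a`, when `c` is the swapping partner. -/
def CliffordFactor.center {V : Type*} (a c : V) : CliffordFactor → V
  | .negIX => a
  | .posIZ => c

namespace GraphRegister

section

variable {V : Type*} {r : GraphRegister V} {a b c : V} {D : LocalClifford → List CliffordFactor}

/-- The local complementations that cancel the word `w` in the vertex operator of `a`, starting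
from its last letter. -/
def cancelWord (a c : V) (w : List CliffordFactor) (r : GraphRegister V) : GraphRegister V :=
  w.foldr (fun f s => s.localComplementation (f.center a c)) r

theorem reduceVOP_eq_cancelWord (D : LocalClifford → List CliffordFactor) (r : GraphRegister V)
    (a c : V) : r.reduceVOP D a c = r.cancelWord a c (D (r.vop a)) := by
  rw [reduceVOP, reductionCenters, List.foldl_map, List.foldl_reverse, cancelWord]
  congr! 3

theorem localComplementation_center_adj (hac : r.graph.Adj a c) (f : CliffordFactor) :
    (r.localComplementation (f.center a c)).graph.Adj a c := by
  cases f
  · exact (localComplement_adj_center _ _).2 hac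
  · exact ((localComplement_adj_center _ _).2 hac.symm).symm

theorem localComplementation_center_vop (hac : r.graph.Adj a c) (f : CliffordFactor) :
    (r.localComplementation (f.center a c)).vop a = r.vop a * f.val⁻¹ := by
  cases f <;>
    simp [CliffordFactor.center, CliffordFactor.val, localComplementation, sqrtNegIX, sqrtIZ,
      hac.ne, hac.symm]

theorem cancelWord_adj (hac : r.graph.Adj a c) (w : List CliffordFactor) :
    (r.cancelWord a c w).graph.Adj a c := by
  induction w with
  | nil => exact hac
  | cons f w ih => exact localComplementation_center_adj ih f

theorem cancelWord_vop (hac : r.graph.Adj a c) (w : List CliffordFactor) :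
    (r.cancelWord a c w).vop a = r.vop a * (w.map CliffordFactor.val).prod⁻¹ := by
  induction w with
  | nil => simp [cancelWord]
  | cons f w ih =>
    rw [List.map_cons, List.prod_cons, mul_inv_rev, ← mul_assoc, ← ih]
    exact localComplementation_center_vop (cancelWord_adj hac w) f

theorem exists_cancelWord_vop_eq_mul {v : V} (hva : v ≠ a) (hvc : v ≠ c)
    (w : List CliffordFactor) :
    ∃ q ∈ zSet, (r.cancelWord a c w).vop v = r.vop v * q := by
  induction w with
  | nil => exact ⟨1, one_mem_zSet, (mul_one _).symm⟩
  | cons f w ih =>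
    obtain ⟨q, hq, hv⟩ := ih
    have hvf : v ≠ f.center a c := by cases f <;> assumption
    refine ⟨q * cliffordClass (localComplementationOp (r.cancelWord a c w).graph (f.center a c) v),
      mul_mem_zSet hq (cliffordClass_localComplementationOp_mem_zSet _ hvf), ?_⟩
    rw [← mul_assoc, ← hv]
    exact localComplementation_vop _ _ _

theorem cancelWord_replicate_four_graph (a c : V) (f : CliffordFactor) :
    (r.cancelWord a c (List.replicate 4 f)).graph = r.graph := by
  have hinv := localComplement_involutive (f.center a c)
  exact (hinv _).trans (hinv _)

theorem reduceVOP_vop_self (hD : IsDecompositionTable D) (hac : r.graph.Adj a c) :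
    (r.reduceVOP D a c).vop a = 1 := by
  rw [reduceVOP_eq_cancelWord, cancelWord_vop hac, (hD _).2, mul_inv_cancel]

theorem reduceVOP_adj (hac : r.graph.Adj a c) : (r.reduceVOP D a c).graph.Adj a c := by
  rw [reduceVOP_eq_cancelWord]
  exact cancelWord_adj hac _

theorem exists_reduceVOP_vop_eq_mul {v : V} (hva : v ≠ a) (hvc : v ≠ c) :
    ∃ q ∈ zSet, (r.reduceVOP D a c).vop v = r.vop v * q := by
  rw [reduceVOP_eq_cancelWord]
  exact exists_cancelWord_vop_eq_mul hva hvc _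

theorem reduceVOP_vop_mem_zSet (hab : a ≠ b) (hc : c ∈ r.otherNeighbors a b)
    (hb : r.vop b ∈ zSet) : (r.reduceVOP D a c).vop b ∈ zSet := by
  obtain ⟨q, hq, hvop⟩ := exists_reduceVOP_vop_eq_mul (D := D) (r := r) hab.symm (Ne.symm hc.2)
  exact hvop ▸ mul_mem_zSet hb hq

/-- A word of length at most five for the identity is empty or a fourth power of a letter, and
four local complementations about the same vertex restore the graph. -/
theorem reduceVOP_graph_of_vop_eq_one (hD : IsDecompositionTable D) (ha : r.vop a = 1) (c : V) :
    (r.reduceVOP D a c).graph = r.graph := by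
  obtain ⟨hlength, hprod⟩ := hD (r.vop a)
  rw [reduceVOP_eq_cancelWord]
  rcases eq_nil_or_replicate_of_prod_eq_one hlength (hprod.trans ha) with hw | ⟨f, hw⟩
  · rw [hw]; rfl
  · rw [hw, cancelWord_replicate_four_graph]

end

section

variable {V : Type*} [Fintype V] [DecidableEq V] {r : GraphRegister V} {ψ : QState V}

theorem Represents.localComplementation (h : r.Represents ψ) (a : V) :
    (r.localComplementation a).Represents ψ := by
  obtain ⟨C, hC⟩ := r.exists_representatives
  refine represents_of_eqUpToPhase (C := fun v => C v * localComplementationOp r.graph a v)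
    (fun v => ?_) ((h C hC).trans ?_)
  · rw [localComplementation_vop, ← hC]
    rfl
  · have hstate := (vopState_localComplement r.graph a).symm.mulVec
      (tensorOp fun v => cliffordMat (C v))
    rwa [vopState, Matrix.mulVec_mulVec, tensorOp_mul] at hstate

theorem Represents.reduceVOP (h : r.Represents ψ) (D : LocalClifford → List CliffordFactor)
    (a c : V) : (r.reduceVOP D a c).Represents ψ := by
  rw [reduceVOP_eq_cancelWord]
  induction D (r.vop a) with
  | nil => exact h
  | cons f w ih => exact ih.localComplementation _

end

end GraphRegister

/-! ### Table lookup -/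

section Lookup

theorem card_mul_sum_comp_mul {κ ι V R : Type*} [Fintype κ] [DecidableEq κ] [Fintype ι]
    [AddGroup ι] [Fintype V] [DecidableEq V] [CommSemiring R] {p : κ → V}
    (hp : Function.Injective p) (φ : (κ → ι) → R) {B : (V → ι) → R}
    (hB : DependsOn B (Set.range p)ᶜ) :
    Fintype.card (κ → ι) * ∑ y, φ (y ∘ p) * B y = (∑ t, φ t) * ∑ y, B y := by
  have hshift : ∀ t : κ → ι, ∑ y, φ (y ∘ p + t) * B y = ∑ y, φ (y ∘ p) * B y := by
    intro t
    refine Fintype.sum_equiv (Equiv.addRight (Function.extend p t 0)) _ _ fun y => ?_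
    have hφ : (y + Function.extend p t 0) ∘ p = y ∘ p + t := by
      funext k
      simp [hp.extend_apply]
    have hBy : B (y + Function.extend p t 0) = B y :=
      hB fun v hv => by simp [Function.extend_apply' _ _ _ hv]
    rw [Equiv.coe_addRight, hφ, hBy]
  calc Fintype.card (κ → ι) * ∑ y, φ (y ∘ p) * B y
      = ∑ t : κ → ι, ∑ y, φ (y ∘ p + t) * B y := by
        simp only [hshift, Finset.sum_const, Finset.card_univ, nsmul_eq_mul]
    _ = ∑ y, (∑ t, φ (y ∘ p + t)) * B y := by
        rw [Finset.sum_comm]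
        simp only [Finset.sum_mul]
    _ = (∑ t, φ t) * ∑ y, B y := by
        rw [Finset.mul_sum]
        exact Finset.sum_congr rfl fun y _ => by
          rw [← Equiv.sum_comp (Equiv.addLeft (y ∘ p)) φ]; rfl

theorem sdiff_sup_ite_adj_edge {V : Type*} (G : SimpleGraph V) (a b : V) [Decidable (G.Adj a b)] :
    G \ SimpleGraph.edge a b ⊔ (if G.Adj a b then SimpleGraph.edge a b else ⊥) = G := by
  split_ifs with hab
  · exact sdiff_sup_cancel ((SimpleGraph.edge_le_iff _).2 (Or.inr hab))
  · rw [sup_bot_eq, sdiff_eq_left, SimpleGraph.disjoint_edge]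
    exact hab

theorem GraphRegister.not_adj_of_otherNeighbors_eq_empty {V : Type*} {r : GraphRegister V}
    {a b : V} (hab : a ≠ b) (hempty : r.otherNeighbors a b = ∅) (v : V) :
    ¬(r.graph \ SimpleGraph.edge a b).Adj a v := by
  rintro ⟨hadj, hedge⟩
  obtain rfl : v = b := by
    by_contra hvb
    exact Set.eq_empty_iff_forall_notMem.1 hempty v ⟨hadj, hvb⟩
  exact hedge ((SimpleGraph.edge_adj _ _ _ _).2 ⟨Or.inl ⟨rfl, rfl⟩, hab⟩)

variable {V : Type*} [Fintype V] [DecidableEq V]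

theorem vopState_apply (G : SimpleGraph V) (C : V → cliffordOps) (x : V → Fin 2) :
    vopState G C x = ((Real.sqrt 2 : ℝ) : ℂ)⁻¹ ^ Fintype.card V *
      ∑ y, (∏ v, cliffordMat (C v) (x v) (y v)) * graphSign G y := by
  rw [vopState_eq_smul]
  rfl

theorem controlledZ_mulVec (a b : V) (ψ : QState V) (x : V → Fin 2) :
    (controlledZ a b).mulVec ψ x = czSign s(a, b) x * ψ x :=
  Matrix.mulVec_diagonal _ _ _

theorem graphSign_sup {G H : SimpleGraph V} (h : Disjoint G H) (x : V → Fin 2) :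
    graphSign (G ⊔ H) x = graphSign G x * graphSign H x := by
  rw [← h.symmDiff_eq_sup, graphSign_symmDiff]

theorem graphSign_ite_edge {a b : V} (hab : a ≠ b) (e : Bool) (x : V → Fin 2) :
    graphSign (if e then SimpleGraph.edge a b else ⊥) x =
      graphSign (if e then ⊤ else ⊥ : SimpleGraph (Fin 2)) (x ∘ ![a, b]) := by
  have htop : (⊤ : SimpleGraph (Fin 2)) = SimpleGraph.edge 0 1 := by
    ext v w
    fin_cases v <;> fin_cases w <;> simp [SimpleGraph.edge_adj]
  cases e
  · simp [graphSign_bot]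
  · simp [htop, graphSign_edge, hab, czSign_mk]

theorem cliffordMat_mul_graphSign_update {G : SimpleGraph V} {a : V} {C : cliffordOps}
    (h : (∀ v, ¬G.Adj a v) ∨ cliffordClass C ∈ zSet) (i : Fin 2) (y : V → Fin 2) :
    cliffordMat C i (y a) * graphSign G (Function.update y a i) =
      cliffordMat C i (y a) * graphSign G y := by
  rcases eq_or_ne i (y a) with rfl | hi
  · rw [Function.update_eq_self]
  · rcases h with hisolated | hdiag
    · obtain rfl : i = y a + 1 := by omega
      simp [graphSign_update, hisolated]
    · rw [cliffordMat_apply_eq_zero hdiag hi, zero_mul, zero_mul]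

/-- The part of the summand at `y` of the amplitude at `x` of `|G; C⟩` that does not depend on
`y a` and `y b`, provided that `a` and `b` have diagonal vertex operators or no neighbours. -/
def restSummand (G : SimpleGraph V) (C : V → cliffordOps) (a b : V) (x y : V → Fin 2) : ℂ :=
  (∏ v ∈ {a, b}ᶜ, cliffordMat (C v) (x v) (y v)) *
    graphSign G (Function.update (Function.update y a (x a)) b (x b))

theorem dependsOn_restSummand (G : SimpleGraph V) (C : V → cliffordOps) (a b : V)
    (x : V → Fin 2) : DependsOn (restSummand G C a b x) (Set.range ![a, b])ᶜ := by
  intro y z hyz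
  have heq : ∀ v, v ≠ a → v ≠ b → y v = z v := fun v hva hvb =>
    hyz v (by simp [hva, hvb])
  have hupdate : Function.update (Function.update y a (x a)) b (x b) =
      Function.update (Function.update z a (x a)) b (x b) := by
    grind [Function.update_apply]
  rw [restSummand, restSummand, hupdate]
  congr 1
  exact Finset.prod_congr rfl fun v hv => by grind [Finset.mem_compl]

theorem restSummand_congr (G : SimpleGraph V) {C C' : V → cliffordOps} {a b : V}
    (h : ∀ v, v ≠ a → v ≠ b → C v = C' v) : restSummand G C a b = restSummand G C' a b := by
  funext x y
  rw [restSummand, restSummand]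
  congr 1
  exact Finset.prod_congr rfl fun v hv => by grind [Finset.mem_compl]

/-- In the presence of a nonzero entry of the vertex operators of `a` and `b`, the sign of `G` does
not change when `y a` and `y b` are replaced by `x a` and `x b`. -/
theorem prod_cliffordMat_mul_graphSign_sup_edge {G : SimpleGraph V} {a b : V} (hab : a ≠ b)
    (hG : ¬G.Adj a b) (e : Bool) {C : V → cliffordOps}
    (ha : (∀ v, ¬G.Adj a v) ∨ cliffordClass (C a) ∈ zSet)
    (hb : (∀ v, ¬G.Adj b v) ∨ cliffordClass (C b) ∈ zSet) (x y : V → Fin 2) :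
    (∏ v, cliffordMat (C v) (x v) (y v)) *
        graphSign (G ⊔ if e then SimpleGraph.edge a b else ⊥) y =
      (∏ k, cliffordMat ((C ∘ ![a, b]) k) ((x ∘ ![a, b]) k) ((y ∘ ![a, b]) k)) *
        graphSign (if e then ⊤ else ⊥) (y ∘ ![a, b]) * restSummand G C a b x y := by
  have hdisj : Disjoint G (if e then SimpleGraph.edge a b else ⊥) := by
    split_ifs
    exacts [G.disjoint_edge.2 hG, disjoint_bot_right]
  have hsign : cliffordMat (C a) (x a) (y a) * cliffordMat (C b) (x b) (y b) * graphSign G y =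
      cliffordMat (C a) (x a) (y a) * cliffordMat (C b) (x b) (y b) *
        graphSign G (Function.update (Function.update y a (x a)) b (x b)) := by
    have hsign_a := cliffordMat_mul_graphSign_update ha (x a) y
    have hsign_b := cliffordMat_mul_graphSign_update hb (x b) (Function.update y a (x a))
    rw [Function.update_of_ne hab.symm] at hsign_b
    grind
  rw [graphSign_sup hdisj, graphSign_ite_edge hab, ← Finset.prod_mul_prod_compl {a, b},
    Finset.prod_pair hab, restSummand]
  simp only [Fin.prod_univ_two, Function.comp_apply, Matrix.cons_val_zero, Matrix.cons_val_one]
  grind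

theorem vopState_sup_edge {G : SimpleGraph V} {a b : V} (hab : a ≠ b) (hG : ¬G.Adj a b) (e : Bool)
    {C : V → cliffordOps} (ha : (∀ v, ¬G.Adj a v) ∨ cliffordClass (C a) ∈ zSet)
    (hb : (∀ v, ¬G.Adj b v) ∨ cliffordClass (C b) ∈ zSet) (x : V → Fin 2) :
    vopState (G ⊔ if e then SimpleGraph.edge a b else ⊥) C x =
      (((Real.sqrt 2 : ℝ) : ℂ)⁻¹ ^ Fintype.card V / 2 * ∑ y, restSummand G C a b x y) *
        vopState (if e then ⊤ else ⊥) (C ∘ ![a, b]) (x ∘ ![a, b]) := by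
  have hpair : Function.Injective ![a, b] := by
    simp [Function.Injective, Fin.forall_fin_two, hab, hab.symm]
  have hsqrt : (((Real.sqrt 2 : ℝ) : ℂ)⁻¹) ^ 2 = 1 / 2 := by
    rw [inv_pow, ← Complex.ofReal_pow, Real.sq_sqrt zero_le_two]
    simp
  have hsum := card_mul_sum_comp_mul hpair
    (fun t => (∏ k, cliffordMat ((C ∘ ![a, b]) k) ((x ∘ ![a, b]) k) (t k)) *
      graphSign (if e then ⊤ else ⊥) t) (dependsOn_restSummand G C a b x)
  simp only [vopState_apply, prod_cliffordMat_mul_graphSign_sup_edge hab hG e ha hb,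
    Fintype.card_fin, hsqrt]
  simp only [Fintype.card_pi, Fintype.card_fin, Finset.prod_const, Finset.card_univ] at hsum
  push_cast at hsum
  linear_combination ((Real.sqrt 2 : ℝ) : ℂ)⁻¹ ^ Fintype.card V / 4 * hsum

theorem EqUpToPhase.controlledZ_vopState_sup_edge {G : SimpleGraph V} {a b : V} (hab : a ≠ b)
    (hG : ¬G.Adj a b) {e e' : Bool} {C C' : V → cliffordOps}
    (hCC' : ∀ v, v ≠ a → v ≠ b → C v = C' v)
    (ha : (∀ v, ¬G.Adj a v) ∨ cliffordClass (C a) ∈ zSet ∧ cliffordClass (C' a) ∈ zSet)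
    (hb : (∀ v, ¬G.Adj b v) ∨ cliffordClass (C b) ∈ zSet ∧ cliffordClass (C' b) ∈ zSet)
    (h : EqUpToPhase ((controlledZ 0 1).mulVec (vopState (if e then ⊤ else ⊥) (C ∘ ![a, b])))
      (vopState (if e' then ⊤ else ⊥) (C' ∘ ![a, b]))) :
    EqUpToPhase
      ((controlledZ a b).mulVec (vopState (G ⊔ if e then SimpleGraph.edge a b else ⊥) C))
      (vopState (G ⊔ if e' then SimpleGraph.edge a b else ⊥) C') := by
  obtain ⟨z, hz, hpair⟩ := h
  refine ⟨z, hz, funext fun x => ?_⟩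
  have hx : czSign s(a, b) x * vopState (if e then ⊤ else ⊥) (C ∘ ![a, b]) (x ∘ ![a, b]) =
      z * vopState (if e' then ⊤ else ⊥) (C' ∘ ![a, b]) (x ∘ ![a, b]) := by
    have hcz : czSign s(a, b) x = czSign s(0, 1) (x ∘ ![a, b]) := by simp [czSign_mk]
    rw [hcz, ← controlledZ_mulVec, hpair]
    rfl
  rw [controlledZ_mulVec, Pi.smul_apply, smul_eq_mul,
    vopState_sup_edge hab hG e (ha.imp_right And.left) (hb.imp_right And.left),
    vopState_sup_edge hab hG e' (ha.imp_right And.right) (hb.imp_right And.right),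
    restSummand_congr G hCC']
  linear_combination
    (((Real.sqrt 2 : ℝ) : ℂ)⁻¹ ^ Fintype.card V / 2 * ∑ y, restSummand G C' a b x y) * hx

theorem PhaseTable.IsCorrect.eqUpToPhase {T : PhaseTable} (hT : T.IsCorrect) (e : Bool)
    {C C' : Fin 2 → cliffordOps}
    (h₀ : cliffordClass (C' 0) = (T e (cliffordClass (C 0)) (cliffordClass (C 1))).2.1)
    (h₁ : cliffordClass (C' 1) = (T e (cliffordClass (C 0)) (cliffordClass (C 1))).2.2) :
    EqUpToPhase ((controlledZ 0 1).mulVec (vopState (if e then ⊤ else ⊥) C))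
      (vopState (if (T e (cliffordClass (C 0)) (cliffordClass (C 1))).1 then ⊤ else ⊥) C') := by
  refine hT e _ _ _ ?_ C' (Fin.forall_fin_two.2 ⟨h₀, h₁⟩)
  exact GraphRegister.represents_of_eqUpToPhase (C := C) (Fin.forall_fin_two.2 ⟨rfl, rfl⟩)
    ⟨1, norm_one, (one_smul _ _).symm⟩

theorem GraphRegister.Represents.lookupCPhase {T : PhaseTable} (hT : T.IsCorrect)
    (hTz : T.PreservesZ) {r : GraphRegister V} {ψ : QState V} (h : r.Represents ψ) {a b : V}
    (hab : a ≠ b) (hr : r.ReadyForLookup a b) :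
    (r.lookupCPhase T a b).Represents ((controlledZ a b).mulVec ψ) := by
  classical
  obtain ⟨C, hC⟩ := r.exists_representatives
  set e := decide (r.graph.Adj a b) with he
  obtain ⟨U₁, hU₁⟩ := cliffordClass_surjective (T e (r.vop a) (r.vop b)).2.1
  obtain ⟨U₂, hU₂⟩ := cliffordClass_surjective (T e (r.vop a) (r.vop b)).2.2
  set C' := Function.update (Function.update C a U₁) b U₂ with hC'
  have hC'a : C' a = U₁ := by simp [hC', hab]
  have hC'b : C' b = U₂ := by simp [hC']
  have hpreserves := hTz e (r.vop a) (r.vop b)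
  have hgraph := sdiff_sup_ite_adj_edge r.graph a b
  have hG : ¬(r.graph \ SimpleGraph.edge a b).Adj a b := by simp [SimpleGraph.edge_adj, hab]
  refine represents_of_eqUpToPhase (C := C') (fun v => ?_) (((h C hC).mulVec _).trans ?_)
  · rcases eq_or_ne v b with rfl | hvb
    · simp [GraphRegister.lookupCPhase, hC'b, hU₂, he]
    · rcases eq_or_ne v a with rfl | hva
      · simp [GraphRegister.lookupCPhase, hvb, hC'a, hU₁, he]
      · simp [GraphRegister.lookupCPhase, hC', hva, hvb, hC]
  · have hstate := EqUpToPhase.controlledZ_vopState_sup_edge (C := C) (C' := C') (e := e) hab hG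
      (fun v hva hvb => by simp [hC', hva, hvb])
      (hr.1.imp (not_adj_of_otherNeighbors_eq_empty hab) fun hz => by
        rw [hC, hC'a, hU₁]
        exact ⟨hz, hpreserves.1 hz⟩)
      (hr.2.imp (fun hempty => SimpleGraph.edge_comm b a ▸
          not_adj_of_otherNeighbors_eq_empty hab.symm hempty) fun hz => by
        rw [hC, hC'b, hU₂]
        exact ⟨hz, hpreserves.2 hz⟩)
      (hT.eqUpToPhase e (C := C ∘ ![a, b]) (C' := C' ∘ ![a, b])
        (by simp [hC'a, hU₁, hC]) (by simp [hC'b, hU₂, hC]))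
    simp only [Function.comp_apply, Matrix.cons_val_zero, Matrix.cons_val_one, hC, he,
      decide_eq_true_eq, hgraph] at hstate
    exact hstate

end Lookup

/-! ### Existence of the phase table -/

section PhaseTable

variable {V : Type*} [Fintype V] [DecidableEq V]

/-- The correlation operators of `G`, conjugated with the vertex operators, stabilize `|G; C⟩`. -/
theorem tensorOp_matrix_mulVec_vopState {G : SimpleGraph V} {C : V → cliffordOps} {a : V}
    {p : V → PauliLabel} (ha : MapsPauli (cliffordClass (C a)) .X (p a))
    (hN : ∀ v, G.Adj a v → MapsPauli (cliffordClass (C v)) .Z (p v)) :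
    (tensorOp fun v => open Classical in if v = a ∨ G.Adj a v then (p v).matrix else 1).mulVec
      (vopState G C) = vopState G C := by
  classical
  have hcomm : (tensorOp fun v => if v = a ∨ G.Adj a v then (p v).matrix else 1) *
      tensorOp (fun v => cliffordMat (C v)) =
        tensorOp (fun v => cliffordMat (C v)) * correlationOp G a := by
    rw [correlationOp, tensorOp_mul, tensorOp_mul]
    congr 1
    funext v
    rcases eq_or_ne v a with rfl | hva
    · simpa [PauliLabel.matrix] using (mapsPauli_cliffordClass.1 ha).symm
    · by_cases hadj : G.Adj a v
      · simpa [hva, hadj, PauliLabel.matrix] using (mapsPauli_cliffordClass.1 (hN v hadj)).symm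
      · simp [hva, hadj]
  have hfixed : (correlationOp G a).mulVec (graphState G) = graphState G :=
    (correlationOp_fixed_iff G _).2 ⟨1, (one_smul _ _).symm⟩ a
  rw [vopState, Matrix.mulVec_mulVec, hcomm, ← Matrix.mulVec_mulVec, hfixed]

theorem vopState_update_apply {G : SimpleGraph V} {C : V → cliffordOps} {b : V} {W : cliffordOps}
    {c : Fin 2 → ℂ} (hW : ∀ i j, cliffordMat W i j = c i * cliffordMat (C b) i j)
    (x : V → Fin 2) :
    vopState G (Function.update C b W) x = c (x b) * vopState G C x := by
  have hprod : ∀ y : V → Fin 2, ∏ v, cliffordMat (Function.update C b W v) (x v) (y v) =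
      c (x b) * ∏ v, cliffordMat (C v) (x v) (y v) := by
    intro y
    rw [← Finset.mul_prod_erase _ _ (Finset.mem_univ b),
      ← Finset.mul_prod_erase _ (fun v => cliffordMat (C v) (x v) (y v)) (Finset.mem_univ b),
      Function.update_self, hW, mul_assoc]
    congr 2
    exact Finset.prod_congr rfl fun v hv => by
      rw [Function.update_of_ne (Finset.ne_of_mem_erase hv)]
  rw [vopState_apply, vopState_apply, mul_left_comm]
  simp only [hprod, mul_assoc, Finset.mul_sum]

theorem cliffordMat_zOp_pow_mul (k : ℕ) (U : cliffordOps) (i j : Fin 2) :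
    cliffordMat (zOp ^ k * U) i j = (-1) ^ (k * i : ℕ) * cliffordMat U i j := by
  induction k with
  | zero => simp
  | succ k ih =>
    rw [pow_succ', mul_assoc, cliffordMat_mul]
    change (pauliZ * cliffordMat (zOp ^ k * U)) i j = _
    fin_cases i <;> simp [pauliZ, Matrix.mul_apply] at ih ⊢ <;> simp [ih, pow_succ]

theorem cliffordClass_zOp_pow_mem_zSet (k : ℕ) : cliffordClass (zOp ^ k) ∈ zSet := by
  induction k with
  | zero => exact one_mem_zSet
  | succ k ih => exact mul_mem_zSet ih cliffordClass_zOp_mem_zSet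

/-- On the support of `ψ`, `x a ≡ t + e * x b` modulo `2`, hence `x a * x b ≡ (t + e) * x b`. -/
theorem controlledZ_mulVec_of_parity {ψ : QState V} {a b : V} {t e : ℕ}
    (h : ∀ x, (-1) ^ (t + x a + e * x b : ℕ) * ψ x = ψ x) (x : V → Fin 2) :
    (controlledZ a b).mulVec ψ x = (-1) ^ ((t + e) * x b : ℕ) * ψ x := by
  rw [controlledZ_mulVec, czSign_mk]
  rcases eq_or_ne (ψ x) 0 with hψ | hψ
  · rw [hψ, mul_zero, mul_zero]
  have hsign := mul_right_cancel₀ hψ ((h x).trans (one_mul _).symm)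
  congr 1
  have hxa : x a = 0 ∨ x a = 1 := by omega
  have hxb : x b = 0 ∨ x b = 1 := by omega
  rcases hxa with hxa | hxa <;> rcases hxb with hxb | hxb <;>
    simp [hxa, hxb, pow_add] at hsign ⊢ <;> grind

/-- The stabilizer of `a` is `± Z_a Z_b` or `± Z_a`, as `a` is adjacent or not to `b`. -/
theorem neg_one_pow_mul_vopState_of_mapsPauli {G : SimpleGraph V} {C : V → cliffordOps} {a b : V}
    {s : Bool} (hab : a ≠ b) (ha : MapsPauli (cliffordClass (C a)) .X (2, s))
    (hN : ∀ v, G.Adj a v → v = b ∧ cliffordClass (C b) ∈ zSet) (x : V → Fin 2) :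
    (-1) ^ (s.toNat + x a + (open Classical in if G.Adj a b then 1 else 0) * x b : ℕ) *
      vopState G C x = vopState G C x := by
  classical
  have hstab := tensorOp_matrix_mulVec_vopState (p := Function.update (fun _ => .Z) a (2, s))
    (by rwa [Function.update_self]) fun v hv => by
      obtain ⟨rfl, hb⟩ := hN v hv
      rw [Function.update_of_ne hab.symm]
      exact mem_zSet_iff.1 hb
  nth_rw 2 [← hstab]
  rw [tensorOp_mulVec_monomial _ (fun _ i => i) fun v i =>
    if v = a then (-1) ^ (s.toNat + i : ℕ) else if G.Adj a v then (-1) ^ (i : ℕ) else 1]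
  · congr 1
    rw [Finset.prod_eq_mul a b hab]
    · by_cases hadj : G.Adj a b <;> simp [hadj, hab.symm, pow_add]
    · rintro v - ⟨hva, hvb⟩
      rw [if_neg hva, if_neg fun hadj => hvb (hN v hadj).1]
    · exact fun h => absurd (Finset.mem_univ a) h
    · exact fun h => absurd (Finset.mem_univ b) h
  · intro v i j
    rcases eq_or_ne v a with rfl | hva
    · cases s <;> fin_cases i <;> fin_cases j <;> simp [PauliLabel.matrix, pauliZ]
    · by_cases hadj : G.Adj a v <;> fin_cases i <;> fin_cases j <;>
        simp [hva, hadj, PauliLabel.matrix, pauliZ]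

theorem exists_controlledZ_mulVec_vopState {G : SimpleGraph V} {C : V → cliffordOps} {a b : V}
    (hab : a ≠ b) (ha : MapsXToZ (cliffordClass (C a)))
    (hN : ∀ v, G.Adj a v → v = b ∧ cliffordClass (C b) ∈ zSet) :
    ∃ W, cliffordClass W ∈ zSet ∧
      (controlledZ a b).mulVec (vopState G C) = vopState G (Function.update C b (W * C b)) := by
  classical
  obtain ⟨s, hs⟩ := ha
  have hparity := neg_one_pow_mul_vopState_of_mapsPauli hab hs hN
  refine ⟨zOp ^ (s.toNat + if G.Adj a b then 1 else 0), cliffordClass_zOp_pow_mem_zSet _,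
    funext fun x => ?_⟩
  rw [controlledZ_mulVec_of_parity hparity,
    vopState_update_apply fun i j => cliffordMat_zOp_pow_mul _ (C b) i j]

namespace GraphRegister

/-- The register `r'` represents the outcome of the phase gate on `a`, `b` whenever `r` represents
its input. -/
def PhaseGateMaps (a b : V) (r r' : GraphRegister V) : Prop :=
  ∀ ψ, r.Represents ψ → r'.Represents ((controlledZ a b).mulVec ψ)

variable {r r₁ r' : GraphRegister V} {a b : V}

theorem PhaseGateMaps.of_represents (h : ∀ ψ, r.Represents ψ → r₁.Represents ψ)
    (h' : PhaseGateMaps a b r₁ r') : PhaseGateMaps a b r r' :=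
  fun ψ hψ => h' ψ (h ψ hψ)

theorem PhaseGateMaps.swap (h : PhaseGateMaps a b r r') : PhaseGateMaps b a r r' :=
  fun ψ hψ => controlledZ_comm a b ▸ h ψ hψ

theorem exists_phaseGateMaps_of_mapsXToZ (hab : a ≠ b) (ha : MapsXToZ (r.vop a))
    (hN : ∀ v, r.graph.Adj a v → v = b ∧ r.vop b ∈ zSet) :
    ∃ q ∈ zSet, PhaseGateMaps a b r ⟨r.graph, Function.update r.vop b (q * r.vop b)⟩ := by
  obtain ⟨C, hC⟩ := r.exists_representatives
  simp only [← hC] at ha hN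
  obtain ⟨W, hW, hCZ⟩ := exists_controlledZ_mulVec_vopState hab ha hN
  refine ⟨cliffordClass W, hW, fun ψ hψ => represents_of_eqUpToPhase
    (C := Function.update C b (W * C b)) (fun v => ?_) (hCZ ▸ (hψ C hC).mulVec _)⟩
  rcases eq_or_ne v b with rfl | hvb
  · simp only [Function.update_self, ← hC]
    rfl
  · simp only [Function.update_of_ne hvb, hC]

theorem exists_vop_eq_mul_sqrtIX_pow (r : GraphRegister V) (a : V) (k : ℕ) :
    ∃ r' : GraphRegister V, (∀ ψ, r.Represents ψ → r'.Represents ψ) ∧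
      r'.vop a = r.vop a * sqrtIX ^ k ∧
      (∀ v ≠ a, r.vop v ∈ zSet → r'.vop v ∈ zSet) ∧
      ∀ v, r'.graph.Adj a v ↔ r.graph.Adj a v := by
  induction k with
  | zero => exact ⟨r, fun _ => id, (mul_one _).symm, fun _ _ => id, fun _ => Iff.rfl⟩
  | succ k ih =>
    obtain ⟨r', hrep, hvop, hz, hadj⟩ := ih
    refine ⟨r'.localComplementation a, fun ψ h => (hrep ψ h).localComplementation a, ?_,
      fun v hv h => ?_, fun v => (localComplement_adj_center _ _).trans (hadj v)⟩
    · rw [localComplementation_vop, localComplementationOp, if_pos rfl, hvop, mul_assoc, pow_succ]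
      rfl
    · rw [localComplementation_vop]
      exact mul_mem_zSet (hz v hv h) (cliffordClass_localComplementationOp_mem_zSet _ hv)

theorem exists_mapsXToZ_or_mem_zSet (r : GraphRegister V) (a : V) :
    ∃ r' : GraphRegister V, (∀ ψ, r.Represents ψ → r'.Represents ψ) ∧
      (MapsXToZ (r'.vop a) ∨ r'.vop a ∈ zSet) ∧
      (∀ v ≠ a, r.vop v ∈ zSet → r'.vop v ∈ zSet) ∧
      ∀ v, r'.graph.Adj a v ↔ r.graph.Adj a v := by
  rcases mapsXToZ_or_exists_mul_sqrtIX_pow_mem_zSet (r.vop a) with h | ⟨k, hk⟩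
  · exact ⟨r, fun _ => id, Or.inl h, fun _ _ => id, fun _ => Iff.rfl⟩
  · obtain ⟨r', hrep, hvop, hrest⟩ := r.exists_vop_eq_mul_sqrtIX_pow a k
    exact ⟨r', hrep, Or.inr (hvop ▸ hk), hrest⟩

theorem exists_phaseGateMaps_of_mem_zSet (hab : a ≠ b) (ha : r.vop a ∈ zSet)
    (hb : ∀ v, r.graph.Adj b v → v = a) :
    ∃ r', PhaseGateMaps a b r r' ∧ r'.vop a ∈ zSet ∧ (r.vop b ∈ zSet → r'.vop b ∈ zSet) := by
  by_cases hbz : r.vop b ∈ zSet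
  · exact ⟨r.toggleEdge a b, fun ψ h => h.toggleEdge hab ha hbz, ha, id⟩
  obtain ⟨r₁, hrep, hvop, hz, hadj⟩ := r.exists_mapsXToZ_or_mem_zSet b
  have ha₁ : r₁.vop a ∈ zSet := hz a hab ha
  rcases hvop with hX | hZ
  · obtain ⟨q, hq, hmaps⟩ := exists_phaseGateMaps_of_mapsXToZ hab.symm hX
      fun v hv => ⟨hb v ((hadj v).1 hv), ha₁⟩
    refine ⟨_, hmaps.swap.of_represents hrep, ?_, fun h => absurd h hbz⟩
    simpa using mul_mem_zSet hq ha₁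
  · exact ⟨r₁.toggleEdge a b, PhaseGateMaps.of_represents hrep fun ψ h => h.toggleEdge hab ha₁ hZ,
      ha₁, fun h => absurd h hbz⟩

theorem exists_phaseGateMaps (r : GraphRegister V) (hab : a ≠ b) (hV : ∀ v, v = a ∨ v = b) :
    ∃ r', PhaseGateMaps a b r r' := by
  have hNa : ∀ (r : GraphRegister V) v, r.graph.Adj a v → v = b := fun r v hv =>
    (hV v).resolve_left hv.ne'
  have hNb : ∀ (r : GraphRegister V) v, r.graph.Adj b v → v = a := fun r v hv =>
    (hV v).resolve_right hv.ne'
  by_cases hadj : r.graph.Adj a b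
  · obtain ⟨D, hD⟩ := exists_isDecompositionTable
    have hone : (r.reduceVOP D a b).vop a ∈ zSet := reduceVOP_vop_self hD hadj ▸ one_mem_zSet
    obtain ⟨r', hmaps, -⟩ := exists_phaseGateMaps_of_mem_zSet hab hone (hNb _)
    exact ⟨r', hmaps.of_represents fun ψ hψ => hψ.reduceVOP D a b⟩
  · obtain ⟨r₁, hrep, hvop, -, hadj₁⟩ := r.exists_mapsXToZ_or_mem_zSet a
    rcases hvop with hX | hZ
    · obtain ⟨q, -, hmaps⟩ := exists_phaseGateMaps_of_mapsXToZ hab hX fun v hv =>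
        absurd (hNa r₁ v hv ▸ (hadj₁ v).1 hv) hadj
      exact ⟨_, hmaps.of_represents hrep⟩
    · obtain ⟨r', hmaps, -⟩ := exists_phaseGateMaps_of_mem_zSet hab hZ (hNb _)
      exact ⟨r', hmaps.of_represents hrep⟩

theorem exists_phaseGateMaps_and_mem_zSet_imp (r : GraphRegister V) (hab : a ≠ b)
    (hV : ∀ v, v = a ∨ v = b) :
    ∃ r', PhaseGateMaps a b r r' ∧ (r.vop a ∈ zSet → r'.vop a ∈ zSet) ∧
      (r.vop b ∈ zSet → r'.vop b ∈ zSet) := by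
  by_cases haz : r.vop a ∈ zSet
  · obtain ⟨r', h, hza, hzb⟩ := exists_phaseGateMaps_of_mem_zSet hab haz fun v hv =>
      (hV v).resolve_right hv.ne'
    exact ⟨r', h, fun _ => hza, hzb⟩
  by_cases hbz : r.vop b ∈ zSet
  · obtain ⟨r', h, hzb, hza⟩ := exists_phaseGateMaps_of_mem_zSet hab.symm hbz fun v hv =>
      (hV v).resolve_left hv.ne'
    exact ⟨r', h.swap, hza, fun _ => hzb⟩
  obtain ⟨r', h⟩ := exists_phaseGateMaps r hab hV
  exact ⟨r', h, fun h => absurd h haz, fun h => absurd h hbz⟩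

theorem exists_eq_twoQubitRegister (r : GraphRegister (Fin 2)) :
    ∃ e, r = twoQubitRegister e (r.vop 0) (r.vop 1) := by
  classical
  refine ⟨decide (r.graph.Adj 0 1), ?_⟩
  obtain ⟨G, C⟩ := r
  simp only [twoQubitRegister, GraphRegister.mk.injEq]
  constructor
  · have hsymm := G.adj_comm 0 1
    by_cases hadj : G.Adj 0 1 <;> ext v w <;> fin_cases v <;> fin_cases w <;> simp_all
  · funext v
    fin_cases v <;> rfl

end GraphRegister

end PhaseTable

theorem exists_phaseTable : ∃ T : PhaseTable, T.IsCorrect ∧ T.PreservesZ := by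
  have hline : ∀ (e : Bool) (C₁ C₂ : LocalClifford), ∃ t : Bool × LocalClifford × LocalClifford,
      GraphRegister.PhaseGateMaps 0 1 (twoQubitRegister e C₁ C₂)
        (twoQubitRegister t.1 t.2.1 t.2.2) ∧
      (C₁ ∈ zSet → t.2.1 ∈ zSet) ∧ (C₂ ∈ zSet → t.2.2 ∈ zSet) := by
    intro e C₁ C₂
    obtain ⟨r', hmaps, hz₁, hz₂⟩ := (twoQubitRegister e C₁ C₂).exists_phaseGateMaps_and_mem_zSet_imp
      zero_ne_one (by decide)
    obtain ⟨e', he'⟩ := r'.exists_eq_twoQubitRegister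
    exact ⟨(e', r'.vop 0, r'.vop 1), he' ▸ hmaps, hz₁, hz₂⟩
  choose T hmaps hz using hline
  exact ⟨T, hmaps, hz⟩

/-! ### The procedure `cphase` -/

namespace GraphRegister

section

variable {V : Type*} {D : LocalClifford → List CliffordFactor} {a b c : V}
  {r r' : GraphRegister V}

theorem tryRemoveVOP_iff :
    TryRemoveVOP D a b r r' ↔
      (∃ c ∈ r.otherNeighbors a b, r' = r.reduceVOP D a c) ∨
        r.otherNeighbors a b = ∅ ∧ r' = r := by
  refine or_congr_left ⟨?_, ?_⟩
  · rintro ⟨hne, c, ⟨-, hc⟩ | ⟨h0, -⟩, rfl⟩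
    · exact ⟨c, hc, rfl⟩
    · exact absurd h0 hne.ne_empty
  · rintro ⟨c, hc, rfl⟩
    exact ⟨⟨c, hc⟩, c, Or.inl ⟨⟨c, hc⟩, hc⟩, rfl⟩

theorem exists_tryRemoveVOP (D : LocalClifford → List CliffordFactor) (a b : V)
    (r : GraphRegister V) : ∃ r', TryRemoveVOP D a b r r' := by
  simp only [tryRemoveVOP_iff]
  rcases (r.otherNeighbors a b).eq_empty_or_nonempty with hempty | ⟨c, hc⟩
  · exact ⟨r, Or.inr ⟨hempty, rfl⟩⟩
  · exact ⟨_, Or.inl ⟨c, hc, rfl⟩⟩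

theorem exists_cPhase (D : LocalClifford → List CliffordFactor) (T : PhaseTable) (a b : V)
    (r : GraphRegister V) : ∃ r', CPhase D T a b r r' := by
  obtain ⟨r₁, h₁⟩ := exists_tryRemoveVOP D a b r
  obtain ⟨r₂, h₂⟩ := exists_tryRemoveVOP D b a r₁
  obtain ⟨r₃, h₃⟩ := exists_tryRemoveVOP D a b r₂
  exact ⟨_, r₃, ⟨r₁, r₂, h₁, h₂, h₃⟩, rfl⟩

theorem reduceVOP_vop_self_mem_zSet (hD : IsDecompositionTable D)
    (hc : c ∈ r.otherNeighbors a b) : (r.reduceVOP D a c).vop a ∈ zSet :=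
  reduceVOP_vop_self hD hc.1 ▸ one_mem_zSet

theorem TryRemoveVOP.otherNeighbors_eq_empty_or_vop_eq_one (hD : IsDecompositionTable D)
    (h : TryRemoveVOP D a b r r') : r'.otherNeighbors a b = ∅ ∨ r'.vop a = 1 := by
  rcases tryRemoveVOP_iff.1 h with ⟨c, hc, rfl⟩ | ⟨hempty, rfl⟩
  · exact Or.inr (reduceVOP_vop_self hD hc.1)
  · exact Or.inl hempty

/-- The delicate case is the one where `b` has no other neighbour after step (1): step (3) must not
create one, which holds because by then the vertex operator of `a` is already trivial. -/
theorem PrepareCPhase.readyForLookup (hD : IsDecompositionTable D) (hab : a ≠ b)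
    (h : PrepareCPhase D a b r r') : r'.ReadyForLookup a b := by
  obtain ⟨r₁, r₂, h₁, h₂, h₃⟩ := h
  rcases tryRemoveVOP_iff.1 h₃ with ⟨c, hc, rfl⟩ | ⟨ha, rfl⟩
  · refine ⟨Or.inr (reduceVOP_vop_self_mem_zSet hD hc), ?_⟩
    rcases tryRemoveVOP_iff.1 h₂ with ⟨d, hd, rfl⟩ | ⟨hb, rfl⟩
    · exact Or.inr (reduceVOP_vop_mem_zSet hab hc (reduceVOP_vop_self_mem_zSet hD hd))
    · have hvop : r₂.vop a = 1 :=
        (h₁.otherNeighbors_eq_empty_or_vop_eq_one hD).resolve_left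
          (Set.nonempty_iff_ne_empty.1 ⟨c, hc⟩)
      exact Or.inl (by rwa [otherNeighbors, reduceVOP_graph_of_vop_eq_one hD hvop])
  · refine ⟨Or.inl ha, (h₂.otherNeighbors_eq_empty_or_vop_eq_one hD).imp_right fun hb => ?_⟩
    rw [hb]
    exact one_mem_zSet

theorem reduceVOP_reduceVOP_vop_mem_zSet (hD : IsDecompositionTable D) {d : V} (hab : a ≠ b)
    (hc : c ∈ r.otherNeighbors a b) (hd : d ∈ (r.reduceVOP D a c).otherNeighbors b a) :
    ((r.reduceVOP D a c).reduceVOP D b d).vop a ∈ zSet :=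
  reduceVOP_vop_mem_zSet hab.symm hd (reduceVOP_vop_self_mem_zSet hD hc)

end

section

variable {V : Type*} [Fintype V] [DecidableEq V] {D : LocalClifford → List CliffordFactor} {a b : V}
  {r r' : GraphRegister V} {ψ : QState V}

theorem Represents.tryRemoveVOP (hr : r.Represents ψ) (h : TryRemoveVOP D a b r r') :
    r'.Represents ψ := by
  rcases tryRemoveVOP_iff.1 h with ⟨c, -, rfl⟩ | ⟨-, rfl⟩
  · exact hr.reduceVOP D a c
  · exact hr

theorem Represents.prepareCPhase (hr : r.Represents ψ) (h : PrepareCPhase D a b r r') :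
    r'.Represents ψ := by
  obtain ⟨r₁, r₂, h₁, h₂, h₃⟩ := h
  exact ((hr.tryRemoveVOP h₁).tryRemoveVOP h₂).tryRemoveVOP h₃

theorem Represents.cPhase {T : PhaseTable} (hD : IsDecompositionTable D) (hT : T.IsCorrect)
    (hTz : T.PreservesZ) (hab : a ≠ b) (hr : r.Represents ψ) (h : CPhase D T a b r r') :
    r'.Represents ((controlledZ a b).mulVec ψ) := by
  obtain ⟨r₁, h₁, rfl⟩ := h
  exact (hr.prepareCPhase h₁).lookupCPhase hT hTz hab (h₁.readyForLookup hD hab)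

end

end GraphRegister

end

theorem mainTheorem1 :
    -- every local Clifford operator is a product of at most 5 factors `√(-iX)`, `√(iZ)`
    (∃ D, IsDecompositionTable D) ∧
    -- the two-qubit table exists and can be chosen so that VOPs in `𝒵` stay in `𝒵`
    (∃ T : PhaseTable, T.IsCorrect ∧ T.PreservesZ) ∧
    -- with any such tables, for any register and any two distinct operand vertices
    ∀ (D : LocalClifford → List CliffordFactor) (T : PhaseTable),
      IsDecompositionTable D → T.IsCorrect → T.PreservesZ →
    ∀ (V : Type*) [Fintype V] [DecidableEq V] (a b : V), a ≠ b →
    ∀ (r : GraphRegister V) (ψ : QState V), r.Represents ψ →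
      -- both VOPs in `𝒵`: toggle the edge
      (r.vop a ∈ zSet → r.vop b ∈ zSet →
        (r.toggleEdge a b).Represents (Matrix.mulVec (controlledZ a b) ψ)) ∧
      -- reduction of the VOP of `a` by means of a neighbour `c`
      (∀ c, r.graph.Adj a c →
        (r.reductionCenters D a c).length ≤ 5 ∧
        (r.reduceVOP D a c).Represents ψ ∧
        (r.reduceVOP D a c).vop a = 1 ∧
        (r.reduceVOP D a c).graph.Adj a c ∧
        ∀ v, v ≠ a → v ≠ c → ∃ q ∈ zSet, (r.reduceVOP D a c).vop v = r.vop v * q) ∧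
      -- both VOPs can be reduced with non-operand partners: reduce, then toggle the edge
      (∀ c ∈ r.otherNeighbors a b, ∀ d ∈ (r.reduceVOP D a c).otherNeighbors b a,
        ((r.reduceVOP D a c).reduceVOP D b d).vop a ∈ zSet ∧
        ((r.reduceVOP D a c).reduceVOP D b d).vop b = 1 ∧
        (((r.reduceVOP D a c).reduceVOP D b d).toggleEdge a b).Represents
          (Matrix.mulVec (controlledZ a b) ψ)) ∧
      -- table lookup
      (r.ReadyForLookup a b →
        (r.lookupCPhase T a b).Represents (Matrix.mulVec (controlledZ a b) ψ)) ∧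
      -- the complete procedure `cphase`, for all choices of swapping partners
      (∃ r', GraphRegister.CPhase D T a b r r') ∧
      (∀ r', GraphRegister.PrepareCPhase D a b r r' →
        r'.Represents ψ ∧ r'.ReadyForLookup a b) ∧
      (∀ r', GraphRegister.CPhase D T a b r r' →
        r'.Represents (Matrix.mulVec (controlledZ a b) ψ)) := by
  refine ⟨exists_isDecompositionTable, exists_phaseTable, ?_⟩
  intro D T hD hT hTz V _ _ a b hab r ψ hr
  refine ⟨hr.toggleEdge hab, fun c hac => ?_, fun c hc d hd => ?_, hr.lookupCPhase hT hTz hab,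
    GraphRegister.exists_cPhase D T a b r,
    fun r' h => ⟨hr.prepareCPhase h, h.readyForLookup hD hab⟩,
    fun r' h => hr.cPhase hD hT hTz hab h⟩
  · have hlength : (r.reductionCenters D a c).length ≤ 5 := by
      simpa only [GraphRegister.reductionCenters, List.length_map, List.length_reverse] using
        (hD (r.vop a)).1
    exact ⟨hlength, hr.reduceVOP D a c, GraphRegister.reduceVOP_vop_self hD hac,
      GraphRegister.reduceVOP_adj hac, fun v => GraphRegister.exists_reduceVOP_vop_eq_mul⟩
  · have ha := GraphRegister.reduceVOP_reduceVOP_vop_mem_zSet hD hab hc hd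
    have hb := GraphRegister.reduceVOP_vop_self hD hd.1
    exact ⟨ha, hb, ((hr.reduceVOP D a c).reduceVOP D b d).toggleEdge hab ha (hb ▸ one_mem_zSet)⟩
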